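/- Let $g_k$ denote the standard metric of the unit sphere $S^k\subset\mathbb R^{k+1}$. Let $\eta:S^n\to S^m$ be a $C^2$ map, and for $\theta\in(0,\frac{\pi}{2})$ let $F_\theta:S^n\to S^{m+n+1}\subset\mathbb R^{n+1}\times\mathbb R^{m+1}$ be the map $F_\theta(x)=(\cos\theta\cdot x,\ \sin\theta\cdot\eta(x))$. The map $\eta$ is called a Lawson–Osserman map if there is $\theta\in(0,\frac{\pi}{2})$ such that $F_\theta$ gives a minimal submanifold of $S^{m+n+1}$, i.e. $F_\theta$ is a $C^2$ embedding whose mean curvature vector in $(S^{m+n+1},g_{m+n+1})$ vanishes. Theorem. The map $\eta$ is a Lawson–Osserman map if and only if there is $\theta\in(0,\frac{\pi}{2})$ such that both of the following hold: (1) $\eta:(S^n,F_\theta^*g_{m+n+1})\to(S^m,g_m)$ is harmonic, i.e. its tension field vanishes; (2) at every point of $S^n$, $\displaystyle\sum_{i=1}^n\frac{1}{\cos^2\theta+\lambda_i^2\sin^2\theta}=n$, where $\lambda_1^2,\dots,\lambda_n^2$ are the eigenvalues (with multiplicity) of $\eta^*g_m$ relative to $g_n$ at that point, i.e. the diagonal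 entries of $\eta^*g_m$ in a $g_n$-orthonormal basis of the tangent space that diagonalizes it. Moreover, the angle is the same on both sides: for each $\theta\in(0,\frac{\pi}{2})$, $F_\theta$ gives a minimal submanifold of $S^{m+n+1}$ if and only if (1) and (2) hold for this $\theta$. -/

import Mathlib

open Set Metric Module
open scoped Manifold ContDiff

noncomputable section

namespace LawsonOsserman

/-! ### Fields of bilinear forms, pull-backs -/

/-- A field of bilinear forms on the tangent spaces of the `n`-manifold `M` (below always a
Riemannian metric, or the pull-back of one under a `C²` map). -/
abbrev FormField (n : ℕ) (M : Type*) [TopologicalSpace M]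
    [ChartedSpace (EuclideanSpace ℝ (Fin n)) M] : Type _ :=
  ∀ p : M, LinearMap.BilinForm ℝ (TangentSpace (𝓡 n) p)

/-- The pull-back `φ^* h`, i.e. `(φ^* h)_p (v, w) = h_{φ p} (dφ_p v, dφ_p w)`. -/
def pullback {n m : ℕ} {M N : Type*} [TopologicalSpace M]
    [ChartedSpace (EuclideanSpace ℝ (Fin n)) M] [TopologicalSpace N]
    [ChartedSpace (EuclideanSpace ℝ (Fin m)) N]
    (φ : M → N) (h : FormField m N) : FormField n M :=
  fun p => LinearMap.compl₁₂ (h (φ p))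
    (mfderiv (𝓡 n) (𝓡 m) φ p).toLinearMap (mfderiv (𝓡 n) (𝓡 m) φ p).toLinearMap

/-- The standard metric of the unit sphere of a Euclidean space `V`: the restriction of the
inner product of `V` to tangent vectors of the sphere. -/
def roundMetric {n : ℕ} (V : Type*) [NormedAddCommGroup V] [InnerProductSpace ℝ V]
    [Fact (finrank ℝ V = n + 1)] : FormField n (sphere (0 : V) 1) :=
  fun p => LinearMap.compl₁₂ (innerₗ V)
    (mfderiv (𝓡 n) 𝓘(ℝ, V) (fun x : sphere (0 : V) 1 => (x : V)) p).toLinearMap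
    (mfderiv (𝓡 n) 𝓘(ℝ, V) (fun x : sphere (0 : V) 1 => (x : V)) p).toLinearMap

/-! ### Local coordinates -/

/-- The partial derivative `∂_i f`. -/
def pd {n : ℕ} (i : Fin n) (f : EuclideanSpace ℝ (Fin n) → ℝ) (y : EuclideanSpace ℝ (Fin n)) : ℝ :=
  fderiv ℝ f y (EuclideanSpace.single i 1)

/-- The coefficients `g_{ij}` of `g` in the preferred chart around `p`, at the coordinates `y`. -/
def coeff {n : ℕ} {M : Type*} [TopologicalSpace M] [ChartedSpace (EuclideanSpace ℝ (Fin n)) M]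
    (g : FormField n M) (p : M) (y : EuclideanSpace ℝ (Fin n)) : Matrix (Fin n) (Fin n) ℝ :=
  Matrix.of fun i j =>
    g ((chartAt (EuclideanSpace ℝ (Fin n)) p).symm y)
      (mfderiv (𝓡 n) (𝓡 n) (chartAt (EuclideanSpace ℝ (Fin n)) p).symm y
        (EuclideanSpace.single i 1 : EuclideanSpace ℝ (Fin n)))
      (mfderiv (𝓡 n) (𝓡 n) (chartAt (EuclideanSpace ℝ (Fin n)) p).symm y
        (EuclideanSpace.single j 1 : EuclideanSpace ℝ (Fin n)))

/-- The Christoffel symbols `Γ^k_{ij}` of a metric with coefficient matrix `G`. -/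
def christoffel {n : ℕ} (G : EuclideanSpace ℝ (Fin n) → Matrix (Fin n) (Fin n) ℝ)
    (y : EuclideanSpace ℝ (Fin n)) (k i j : Fin n) : ℝ :=
  (1 / 2) * ∑ l, (G y)⁻¹ k l *
    (pd i (fun z => G z j l) y + pd j (fun z => G z i l) y - pd l (fun z => G z i j) y)

/-- The components of `φ : M → N` in the preferred charts around `p` and `φ p`. -/
def localRep {n m : ℕ} {M N : Type*} [TopologicalSpace M]
    [ChartedSpace (EuclideanSpace ℝ (Fin n)) M] [TopologicalSpace N]
    [ChartedSpace (EuclideanSpace ℝ (Fin m)) N]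
    (φ : M → N) (p : M) (α : Fin m) (y : EuclideanSpace ℝ (Fin n)) : ℝ :=
  chartAt (EuclideanSpace ℝ (Fin m)) (φ p)
    (φ ((chartAt (EuclideanSpace ℝ (Fin n)) p).symm y)) α

/-- The covariant derivative, at `p`, of the vector field `dφ(∂_j)` along `φ` in the direction
`∂_i`, for the Levi-Civita connection of `h` on `N`:
`∂_i ∂_j φ^α + Γ^α_{βγ}(φ) ∂_i φ^β ∂_j φ^γ`. -/
def covDeriv {n m : ℕ} {M N : Type*} [TopologicalSpace M]
    [ChartedSpace (EuclideanSpace ℝ (Fin n)) M] [TopologicalSpace N]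
    [ChartedSpace (EuclideanSpace ℝ (Fin m)) N]
    (h : FormField m N) (φ : M → N) (p : M) (i j : Fin n) (α : Fin m) : ℝ :=
  let y := chartAt (EuclideanSpace ℝ (Fin n)) p p
  pd i (pd j (localRep φ p α)) y +
    ∑ β, ∑ γ, christoffel (coeff h (φ p)) (chartAt (EuclideanSpace ℝ (Fin m)) (φ p) (φ p)) α β γ *
      pd i (localRep φ p β) y * pd j (localRep φ p γ) y

/-! ### Harmonic maps -/

/-- The tension field `tr_g ∇dφ` of `φ : (M, g) → (N, h)` at `p`, by its components in the
preferred charts around `p` and `φ p`: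
`g^{ij} (∂_i ∂_j φ^α - Γ^k_{ij} ∂_k φ^α + Γ^α_{βγ}(φ) ∂_i φ^β ∂_j φ^γ)`. -/
def tension {n m : ℕ} {M N : Type*} [TopologicalSpace M]
    [ChartedSpace (EuclideanSpace ℝ (Fin n)) M] [TopologicalSpace N]
    [ChartedSpace (EuclideanSpace ℝ (Fin m)) N]
    (g : FormField n M) (h : FormField m N) (φ : M → N) (p : M) (α : Fin m) : ℝ :=
  let y := chartAt (EuclideanSpace ℝ (Fin n)) p p
  ∑ i, ∑ j, (coeff g p y)⁻¹ i j *
    (covDeriv h φ p i j α - ∑ k, christoffel (coeff g p) y k i j * pd k (localRep φ p α) y)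

/-- `φ : (M, g) → (N, h)` is a (`C²`) harmonic map: its tension field vanishes. -/
def IsHarmonicMap {n m : ℕ} {M N : Type*} [TopologicalSpace M]
    [ChartedSpace (EuclideanSpace ℝ (Fin n)) M] [TopologicalSpace N]
    [ChartedSpace (EuclideanSpace ℝ (Fin m)) N]
    (g : FormField n M) (h : FormField m N) (φ : M → N) : Prop :=
  ContMDiff (𝓡 n) (𝓡 m) 2 φ ∧ ∀ (p : M) (α : Fin m), tension (n := n) g h φ p α = 0

/-! ### Minimal submanifolds -/

/-- The second fundamental form `B(∂_i, ∂_j)` at `p` of an immersion `F : M → (N, h)`: the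
component of `∇_{∂_i} dF(∂_j)` normal to `dF(T_p M)`, where the tangential component of a vector
`v` is `g^{kl} h(v, dF(∂_l)) dF(∂_k)` with the induced metric `g = F^* h`. -/
def secondFundamentalForm {n m : ℕ} {M N : Type*} [TopologicalSpace M]
    [ChartedSpace (EuclideanSpace ℝ (Fin n)) M] [TopologicalSpace N]
    [ChartedSpace (EuclideanSpace ℝ (Fin m)) N]
    (h : FormField m N) (F : M → N) (p : M) (i j : Fin n) (α : Fin m) : ℝ :=
  let y := chartAt (EuclideanSpace ℝ (Fin n)) p p
  let H := coeff h (F p) (chartAt (EuclideanSpace ℝ (Fin m)) (F p) (F p))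
  covDeriv h F p i j α -
    ∑ k, ∑ l, (coeff (pullback F h) p y)⁻¹ k l *
      (∑ β, ∑ γ, H β γ * covDeriv h F p i j β * pd l (localRep F p γ) y) * pd k (localRep F p α) y

/-- The mean curvature vector of an immersion `F : M → (N, h)` at `p`: the trace of the second
fundamental form with respect to the induced metric, divided by `dim M`. -/
def meanCurvature {n m : ℕ} {M N : Type*} [TopologicalSpace M]
    [ChartedSpace (EuclideanSpace ℝ (Fin n)) M] [TopologicalSpace N]
    [ChartedSpace (EuclideanSpace ℝ (Fin m)) N]
    (h : FormField m N) (F : M → N) (p : M) (α : Fin m) : ℝ :=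
  (1 / (n : ℝ)) * ∑ i, ∑ j,
    (coeff (pullback F h) p (chartAt (EuclideanSpace ℝ (Fin n)) p p))⁻¹ i j *
      secondFundamentalForm h F p i j α

/-- `F` embeds `M` as a (`C²`) minimal submanifold of `(N, h)`: it is a `C²` embedding, and its
mean curvature vector vanishes. -/
def IsMinimalEmbedding {n m : ℕ} {M N : Type*} [TopologicalSpace M]
    [ChartedSpace (EuclideanSpace ℝ (Fin n)) M] [TopologicalSpace N]
    [ChartedSpace (EuclideanSpace ℝ (Fin m)) N]
    (h : FormField m N) (F : M → N) : Prop :=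
  ContMDiff (𝓡 n) (𝓡 m) 2 F ∧ Topology.IsEmbedding F ∧
    (∀ p : M, Function.Injective (mfderiv (𝓡 n) (𝓡 m) F p)) ∧
    ∀ (p : M) (α : Fin m), meanCurvature (n := n) h F p α = 0

/-! ### Lawson-Osserman maps -/

/-- The unit sphere `S^n` in `ℝ^{n+1}`. -/
abbrev S (n : ℕ) : Type := sphere (0 : EuclideanSpace ℝ (Fin (n + 1))) 1

/-- `ℝ^{m+n+2} = ℝ^{n+1} × ℝ^{m+1}` with its Euclidean norm. -/
abbrev Ambient (n m : ℕ) : Type :=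
  WithLp 2 (EuclideanSpace ℝ (Fin (n + 1)) × EuclideanSpace ℝ (Fin (m + 1)))

instance factFinrankEuclidean (n : ℕ) : Fact (finrank ℝ (EuclideanSpace ℝ (Fin (n + 1))) = n + 1) :=
  ⟨finrank_euclideanSpace_fin⟩

instance factFinrankAmbient (n m : ℕ) : Fact (finrank ℝ (Ambient n m) = (m + n + 1) + 1) :=
  ⟨by
    rw [(WithLp.linearEquiv 2 ℝ
      (EuclideanSpace ℝ (Fin (n + 1)) × EuclideanSpace ℝ (Fin (m + 1)))).finrank_eq,
      Module.finrank_prod, finrank_euclideanSpace_fin, finrank_euclideanSpace_fin]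
    omega⟩

theorem graph_mem {n m : ℕ} (θ : ℝ) (η : S n → S m) (x : S n) :
    (WithLp.toLp 2 (Real.cos θ • (x : EuclideanSpace ℝ (Fin (n + 1))),
      Real.sin θ • (η x : EuclideanSpace ℝ (Fin (m + 1)))) : Ambient n m) ∈
      sphere (0 : Ambient n m) 1 := by
  have h : ‖(WithLp.toLp 2 (Real.cos θ • (x : EuclideanSpace ℝ (Fin (n + 1))),
      Real.sin θ • (η x : EuclideanSpace ℝ (Fin (m + 1)))) : Ambient n m)‖ ^ 2 = 1 := by
    rw [WithLp.prod_norm_sq_eq_of_L2]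
    simp [norm_smul]
  rw [mem_sphere_zero_iff_norm]
  exact (sq_eq_sq₀ (norm_nonneg _) zero_le_one).1 (by rw [h, one_pow])

/-- The map `F(x) = (cos θ · x, sin θ · η(x))` from `S^n` to `S^{m+n+1}`. -/
def graphMap {n m : ℕ} (θ : ℝ) (η : S n → S m) (x : S n) : sphere (0 : Ambient n m) 1 :=
  ⟨WithLp.toLp 2 (Real.cos θ • (x : EuclideanSpace ℝ (Fin (n + 1))),
    Real.sin θ • (η x : EuclideanSpace ℝ (Fin (m + 1)))), graph_mem θ η x⟩

/-- The standard metric `g_n` of `S^n`. -/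
abbrev sphereMetric (n : ℕ) : FormField n (S n) :=
  roundMetric (EuclideanSpace ℝ (Fin (n + 1)))

/-- The standard metric `g_{m+n+1}` of `S^{m+n+1}`. -/
abbrev ambientMetric (n m : ℕ) : FormField (m + n + 1) (sphere (0 : Ambient n m) 1) :=
  roundMetric (Ambient n m)

/-- A `C²` map `η : S^n → S^m` is a Lawson-Osserman map if for some `θ ∈ (0, π/2)` the map
`F(x) = (cos θ · x, sin θ · η(x))` gives a minimal submanifold of `S^{m+n+1}`. -/
def IsLawsonOsserman {n m : ℕ} (η : S n → S m) : Prop :=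
  ContMDiff (𝓡 n) (𝓡 m) 2 η ∧
    ∃ θ ∈ Ioo (0 : ℝ) (Real.pi / 2), IsMinimalEmbedding (n := n) (ambientMetric n m) (graphMap θ η)

/-- `μ_1, …, μ_n` are the eigenvalues, with multiplicity, of the bilinear form `b` relative to the
inner product `g`: the diagonal entries of `b` in a `g`-orthonormal basis that diagonalizes `b`. -/
def IsRelEigenvalues {n : ℕ} {V : Type*} [AddCommGroup V] [Module ℝ V]
    (b g : LinearMap.BilinForm ℝ V) (μ : Fin n → ℝ) : Prop :=
  ∃ e : Basis (Fin n) ℝ V, ∀ i j,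
    g (e i) (e j) = (if i = j then 1 else 0) ∧ b (e i) (e j) = (if i = j then μ i else 0)

/-- The two conditions on `η` and `θ`: `η` is harmonic from `(S^n, F^* g_{m+n+1})` to
`(S^m, g_m)`, and at every point `∑ 1 / (cos² θ + λ_i² sin² θ) = n`, where the `λ_i²` are the
eigenvalues of `η^* g_m` relative to `g_n`. -/
def HarmonicAndTrace {n m : ℕ} (θ : ℝ) (η : S n → S m) : Prop :=
  IsHarmonicMap (n := n) (pullback (graphMap θ η) (ambientMetric n m)) (sphereMetric m) η ∧
    ∀ p : S n, ∃ l : Fin n → ℝ,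
      IsRelEigenvalues (pullback (n := n) η (sphereMetric m) p) (sphereMetric n p) (fun i => l i ^ 2) ∧
      ∑ i, 1 / (Real.cos θ ^ 2 + l i ^ 2 * Real.sin θ ^ 2) = (n : ℝ)

end LawsonOsserman

end

/-! Everything is computed in the ambient Euclidean space. Write F for F_θ, let g be the metric
induced by F, Δ the Laplacian of g on vector-valued functions, and e(f) = tr_g ⟨df, df⟩. The Gauss
formula of the unit sphere (`vpd_vpd_eq_gauss`) turns the tension field of a map φ from (S^n, g)
into a sphere into Δφ + e(φ)φ (`ofComponents_tension`), and the mean curvature vector of F into (ΔF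
+ e(F)F)/n (`ofComponents_meanCurvature`), where e(F) = n since F induces g (`energy_gram`).

The core is `laplacian_add_eq_zero_iff`. Since Δ acts blockwise on F = (cos θ · x, sin θ · η),
minimality means Δx = -nx and Δη = -nη. Pairing with the unit vectors x and η gives e(x) = e(η) = n,
so η is harmonic. Conversely, let η be harmonic and e(x) = n. Tracing g gives n = cos²θ e(x) + sin²θ
e(η), hence e(η) = n and Δη = -nη. The radial part of Δx is -e(x)x = -nx. Its tangential part
vanishes: ΔF is normal to the immersion F, and the η-block contributes nothing because Δη is
parallel to η. So Δx = -nx.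

Finally e(x) = tr_g g_n. A g_n-orthonormal basis that diagonalizes η^*g_m also diagonalizes g =
cos²θ g_n + sin²θ η^*g_m, so e(x) is the sum in condition (2) (`energy_eq_sum`). -/

noncomputable section

namespace LawsonOsserman

open Filter Topology
open scoped Matrix

/-! ### Partial derivatives of vector-valued functions and the chain rule. -/

section Calculus

variable {n m : ℕ} {W : Type*} [NormedAddCommGroup W] [NormedSpace ℝ W]

/-- The partial derivative `∂_i f` of a vector-valued function. -/
def vpd (i : Fin n) (f : EuclideanSpace ℝ (Fin n) → W) (y : EuclideanSpace ℝ (Fin n)) : W :=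
  fderiv ℝ f y (EuclideanSpace.single i 1)

theorem sum_smul_single (v : EuclideanSpace ℝ (Fin n)) :
    ∑ i, v i • (EuclideanSpace.single i 1 : EuclideanSpace ℝ (Fin n)) = v := by
  have h := (EuclideanSpace.basisFun (Fin n) ℝ).sum_repr v
  simpa using h

theorem fderiv_eq_sum_vpd (f : EuclideanSpace ℝ (Fin n) → W) (y v : EuclideanSpace ℝ (Fin n)) :
    fderiv ℝ f y v = ∑ i, v i • vpd i f y := by
  conv_lhs => rw [← sum_smul_single v]
  simp [vpd]

theorem vpd_contDiffAt {f : EuclideanSpace ℝ (Fin n) → W} {y : EuclideanSpace ℝ (Fin n)}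
    (hf : ContDiffAt ℝ 2 f y) (i : Fin n) : ContDiffAt ℝ 1 (vpd i f) y := by
  have h : ContDiffAt ℝ 1 (fderiv ℝ f) y := hf.fderiv_right (by norm_num)
  exact h.clm_apply contDiffAt_const

theorem vpd_differentiableAt {f : EuclideanSpace ℝ (Fin n) → W} {y : EuclideanSpace ℝ (Fin n)}
    (hf : ContDiffAt ℝ 2 f y) (i : Fin n) : DifferentiableAt ℝ (vpd i f) y :=
  (vpd_contDiffAt hf i).differentiableAt (by norm_num)

theorem vpd_vpd {f : EuclideanSpace ℝ (Fin n) → W} {y : EuclideanSpace ℝ (Fin n)}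
    (hf : ContDiffAt ℝ 2 f y) (i j : Fin n) :
    vpd i (vpd j f) y =
      fderiv ℝ (fderiv ℝ f) y (EuclideanSpace.single i 1) (EuclideanSpace.single j 1) := by
  have h : ContDiffAt ℝ 1 (fderiv ℝ f) y := hf.fderiv_right (by norm_num)
  have h' : DifferentiableAt ℝ (fderiv ℝ f) y := h.differentiableAt (by norm_num)
  unfold vpd
  rw [fderiv_clm_apply h' (differentiableAt_const _)]
  simp

theorem vpd_comm {f : EuclideanSpace ℝ (Fin n) → W} {y : EuclideanSpace ℝ (Fin n)}
    (hf : ContDiffAt ℝ 2 f y) (i j : Fin n) : vpd i (vpd j f) y = vpd j (vpd i f) y := by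
  rw [vpd_vpd hf, vpd_vpd hf]
  exact (hf.isSymmSndFDerivAt (by simp)) _ _

theorem vpd_congr {f g : EuclideanSpace ℝ (Fin n) → W} {y : EuclideanSpace ℝ (Fin n)}
    (h : f =ᶠ[𝓝 y] g) (i : Fin n) : vpd i f y = vpd i g y := by
  unfold vpd; rw [h.fderiv_eq]

theorem vpd_clm_comp {W' : Type*} [NormedAddCommGroup W'] [NormedSpace ℝ W'] (L : W →L[ℝ] W')
    {f : EuclideanSpace ℝ (Fin n) → W} {y : EuclideanSpace ℝ (Fin n)}
    (hf : DifferentiableAt ℝ f y) (i : Fin n) : vpd i (fun z => L (f z)) y = L (vpd i f y) := by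
  have := (L.hasFDerivAt.comp y hf.hasFDerivAt).fderiv
  unfold vpd
  change fderiv ℝ (L ∘ f) y _ = _
  rw [this]; rfl

theorem vpd_vpd_clm_comp {W' : Type*} [NormedAddCommGroup W'] [NormedSpace ℝ W'] (L : W →L[ℝ] W')
    {f : EuclideanSpace ℝ (Fin n) → W} {y : EuclideanSpace ℝ (Fin n)}
    (hf : ContDiffAt ℝ 2 f y) (i j : Fin n) :
    vpd i (vpd j (fun z => L (f z))) y = L (vpd i (vpd j f) y) := by
  rw [← vpd_clm_comp L (vpd_differentiableAt hf j)]
  apply vpd_congr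
  filter_upwards [hf.eventually (by simp)] with z hz
  exact vpd_clm_comp L (hz.differentiableAt (by norm_num)) j

/-- The chain rule for first partial derivatives. -/
theorem vpd_comp {ψ : EuclideanSpace ℝ (Fin m) → W}
    {u : EuclideanSpace ℝ (Fin n) → EuclideanSpace ℝ (Fin m)} {y : EuclideanSpace ℝ (Fin n)}
    (hψ : DifferentiableAt ℝ ψ (u y)) (hu : DifferentiableAt ℝ u y) (i : Fin n) :
    vpd i (fun z => ψ (u z)) y = ∑ α, vpd i (fun z => u z α) y • vpd α ψ (u y) := by
  have h := (hψ.hasFDerivAt.comp y hu.hasFDerivAt).fderiv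
  have h' : vpd i (fun z => ψ (u z)) y = fderiv ℝ ψ (u y) (vpd i u y) := by
    unfold vpd
    change fderiv ℝ (ψ ∘ u) y _ = _
    rw [h]; rfl
  rw [h', fderiv_eq_sum_vpd]
  refine Finset.sum_congr rfl fun α _ => ?_
  congr 1
  exact (vpd_clm_comp (EuclideanSpace.proj α : EuclideanSpace ℝ (Fin m) →L[ℝ] ℝ) hu i).symm

/-- The chain rule for second partial derivatives. -/
theorem vpd_vpd_comp {ψ : EuclideanSpace ℝ (Fin m) → W}
    {u : EuclideanSpace ℝ (Fin n) → EuclideanSpace ℝ (Fin m)} {y : EuclideanSpace ℝ (Fin n)}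
    (hψ : ContDiffAt ℝ 2 ψ (u y)) (hu : ContDiffAt ℝ 2 u y) (i j : Fin n) :
    vpd i (vpd j (fun z => ψ (u z))) y =
      ∑ α, vpd i (vpd j (fun z => u z α)) y • vpd α ψ (u y) +
      ∑ β, ∑ γ, (vpd i (fun z => u z β) y * vpd j (fun z => u z γ) y) • vpd β (vpd γ ψ) (u y) := by
  have hu1 : DifferentiableAt ℝ u y := hu.differentiableAt (by norm_num)
  have huc (α : Fin m) : ContDiffAt ℝ 2 (fun z => u z α) y :=
    (EuclideanSpace.proj α : EuclideanSpace ℝ (Fin m) →L[ℝ] ℝ).contDiff.contDiffAt.comp y hu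
  have hev : vpd j (fun z => ψ (u z)) =ᶠ[𝓝 y]
      fun z => ∑ α, vpd j (fun z => u z α) z • vpd α ψ (u z) := by
    filter_upwards [hu.eventually (by simp),
      hu.continuousAt.eventually (hψ.eventually (by simp))] with z hz hz'
    exact vpd_comp (hz'.differentiableAt (by norm_num)) (hz.differentiableAt (by norm_num)) j
  have hd1 (α : Fin m) : DifferentiableAt ℝ (vpd j (fun z => u z α)) y :=
    vpd_differentiableAt (huc α) j
  have hd2 (α : Fin m) : DifferentiableAt ℝ (fun z => vpd α ψ (u z)) y :=
    (vpd_differentiableAt hψ α).comp y hu1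
  rw [vpd_congr hev]
  have hprod (α : Fin m) : vpd i (fun z => vpd j (fun z => u z α) z • vpd α ψ (u z)) y =
      vpd i (vpd j (fun z => u z α)) y • vpd α ψ (u y) +
      ∑ β, (vpd i (fun z => u z β) y * vpd j (fun z => u z α) y) • vpd β (vpd α ψ) (u y) := by
    have h := fderiv_fun_smul (hd1 α) (hd2 α)
    have h2 := vpd_comp (vpd_differentiableAt hψ α) hu1 i
    unfold vpd at h h2 ⊢
    rw [h]
    simp only [add_apply, smul_apply,
      ContinuousLinearMap.smulRight_apply]
    rw [h2, add_comm, Finset.smul_sum]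
    congr 1
    refine Finset.sum_congr rfl fun β _ => ?_
    rw [smul_smul, mul_comm]
  have hsum : vpd i (fun z => ∑ α, vpd j (fun z => u z α) z • vpd α ψ (u z)) y =
      ∑ α, vpd i (fun z => vpd j (fun z => u z α) z • vpd α ψ (u z)) y := by
    have := fderiv_fun_sum (𝕜 := ℝ) (u := Finset.univ) (x := y)
      (A := fun α z => vpd j (fun z => u z α) z • vpd α ψ (u z))
      (fun α _ => (hd1 α).smul (hd2 α))
    unfold vpd at this ⊢
    rw [this]; simp
  rw [hsum, Finset.sum_congr rfl fun α _ => hprod α, Finset.sum_add_distrib,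
    Finset.sum_comm (s := Finset.univ) (t := Finset.univ)
    (f := fun α β => (vpd i (fun z => u z β) y * vpd j (fun z => u z α) y) • vpd β (vpd α ψ) (u y))]

end Calculus

/-! ### First fundamental form and Christoffel symbols of an immersion into Euclidean space. -/

section Gram

variable {n m : ℕ} {V : Type*} [NormedAddCommGroup V] [InnerProductSpace ℝ V]

/-- The Gram matrix of the partial derivatives: the coefficients of the first fundamental form. -/
def gram (U : EuclideanSpace ℝ (Fin n) → V) (y : EuclideanSpace ℝ (Fin n)) :
    Matrix (Fin n) (Fin n) ℝ :=
  Matrix.of fun i j => inner ℝ (vpd i U y) (vpd j U y)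

theorem vpd_inner {f g : EuclideanSpace ℝ (Fin n) → V} {y : EuclideanSpace ℝ (Fin n)}
    (hf : DifferentiableAt ℝ f y) (hg : DifferentiableAt ℝ g y) (i : Fin n) :
    vpd i (fun z => inner ℝ (f z) (g z)) y =
      inner ℝ (f y) (vpd i g y) + inner ℝ (vpd i f y) (g y) := by
  unfold vpd; rw [fderiv_inner_apply ℝ hf hg]

/-- The Christoffel symbols of the first kind are `⟨∂_i ∂_j U, ∂_l U⟩`. -/
theorem christoffel_gram {U : EuclideanSpace ℝ (Fin n) → V} {y : EuclideanSpace ℝ (Fin n)}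
    (hU : ContDiffAt ℝ 2 U y) (k i j : Fin n) :
    christoffel (gram U) y k i j =
      ∑ l, (gram U y)⁻¹ k l * inner ℝ (vpd i (vpd j U) y) (vpd l U y) := by
  have hd (i j k : Fin n) : pd i (fun z => gram U z j k) y =
      inner ℝ (vpd j U y) (vpd i (vpd k U) y) + inner ℝ (vpd i (vpd j U) y) (vpd k U y) :=
    vpd_inner (vpd_differentiableAt hU j) (vpd_differentiableAt hU k) i
  unfold christoffel
  rw [Finset.mul_sum]
  refine Finset.sum_congr rfl fun l _ => ?_
  -- Symmetry of second derivatives cancels four of the six products and leaves twice ⟨∂_i ∂_j U,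
  -- ∂_l U⟩, which absorbs the factor 1/2.
  rw [hd, hd, hd, vpd_comm hU j i, vpd_comm hU l i, vpd_comm hU l j,
    real_inner_comm (vpd i (vpd l U) y), real_inner_comm (vpd j (vpd l U) y)]
  ring

theorem vpd_linearIndependent {U : EuclideanSpace ℝ (Fin n) → V} {y : EuclideanSpace ℝ (Fin n)}
    (hU : Function.Injective (fderiv ℝ U y)) : LinearIndependent ℝ (fun i => vpd i U y) := by
  rw [Fintype.linearIndependent_iff]
  intro c hc i
  have h := fderiv_eq_sum_vpd U y (WithLp.toLp 2 c)
  rw [hc, ← map_zero (fderiv ℝ U y)] at h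
  exact congrArg (fun v : EuclideanSpace ℝ (Fin n) => v i) (hU h)

theorem gram_posDef {U : EuclideanSpace ℝ (Fin n) → V} {y : EuclideanSpace ℝ (Fin n)}
    (hU : Function.Injective (fderiv ℝ U y)) : (gram U y).PosDef :=
  Matrix.posDef_gram_of_linearIndependent (𝕜 := ℝ) (vpd_linearIndependent hU)

theorem gram_isUnit {U : EuclideanSpace ℝ (Fin n) → V} {y : EuclideanSpace ℝ (Fin n)}
    (hU : Function.Injective (fderiv ℝ U y)) : IsUnit (gram U y).det :=
  (gram_posDef hU).det_pos.ne'.isUnit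

/-- The Christoffel part of `∂_i ∂_j U` has the same products with the `∂_l U` as `∂_i ∂_j U`. -/
theorem inner_sum_christoffel {U : EuclideanSpace ℝ (Fin n) → V} {y : EuclideanSpace ℝ (Fin n)}
    (hU : ContDiffAt ℝ 2 U y) (hinj : Function.Injective (fderiv ℝ U y)) (i j l : Fin n) :
    inner ℝ (∑ k, christoffel (gram U) y k i j • vpd k U y) (vpd l U y) =
      inner ℝ (vpd i (vpd j U) y) (vpd l U y) := by
  rw [sum_inner]
  set w : Fin n → ℝ := fun l => inner ℝ (vpd i (vpd j U) y) (vpd l U y) with hw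
  have h1 (k : Fin n) : christoffel (gram U) y k i j = ((gram U y)⁻¹.mulVec w) k :=
    christoffel_gram hU k i j
  have h2 : (gram U y).mulVec ((gram U y)⁻¹.mulVec w) = w := by
    rw [Matrix.mulVec_mulVec, Matrix.mul_nonsing_inv _ (gram_isUnit hinj), Matrix.one_mulVec]
  change _ = w l
  rw [← h2]
  simp only [Matrix.mulVec, dotProduct] at h1 ⊢
  refine Finset.sum_congr rfl fun k _ => ?_
  rw [h1, real_inner_smul_left, real_inner_comm, mul_comm]; rfl

end Gram

/-! ### Maps into the unit sphere and the Gauss formula. -/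

section Sphere

variable {n m : ℕ} {V : Type*} [NormedAddCommGroup V] [InnerProductSpace ℝ V]

theorem inner_vpd_eq_zero {U : EuclideanSpace ℝ (Fin n) → V} {y : EuclideanSpace ℝ (Fin n)}
    (hU : DifferentiableAt ℝ U y) (h1 : ∀ z, ‖U z‖ = 1) (i : Fin n) :
    inner ℝ (U y) (vpd i U y) = 0 := by
  have h := vpd_inner hU hU i
  have hc : (fun z => inner ℝ (U z) (U z)) = fun _ => (1 : ℝ) := by
    funext z; rw [real_inner_self_eq_norm_sq, h1, one_pow]
  rw [hc, real_inner_comm (U y)] at h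
  have h0 : vpd i (fun _ => (1 : ℝ)) y = 0 := by simp [vpd]
  linarith

/-- Differentiate ⟨U, ∂_j U⟩ = 0, itself the derivative of ⟨U, U⟩ = 1. -/
theorem inner_vpd_vpd {U : EuclideanSpace ℝ (Fin n) → V} {y : EuclideanSpace ℝ (Fin n)}
    (hU : ContDiffAt ℝ 2 U y) (h1 : ∀ z, ‖U z‖ = 1) (i j : Fin n) :
    inner ℝ (U y) (vpd i (vpd j U) y) = - inner ℝ (vpd i U y) (vpd j U y) := by
  have hev : (fun z => inner ℝ (U z) (vpd j U z)) =ᶠ[𝓝 y] fun _ => (0 : ℝ) := by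
    filter_upwards [hU.eventually (by simp)] with z hz
    exact inner_vpd_eq_zero (hz.differentiableAt (by norm_num)) h1 j
  have h := vpd_inner (hU.differentiableAt (by norm_num)) (vpd_differentiableAt hU j) i
  rw [vpd_congr hev] at h
  have h0 : vpd i (fun _ => (0 : ℝ)) y = 0 := by simp [vpd]
  linarith

/-- A vector orthogonal to the position and to all tangent vectors of a parametrized hypersurface
of the unit sphere vanishes. -/
theorem eq_zero_of_inner_vpd [Fact (finrank ℝ V = m + 1)] {ψ : EuclideanSpace ℝ (Fin m) → V}
    {z : EuclideanSpace ℝ (Fin m)} (hψ : DifferentiableAt ℝ ψ z)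
    (hinj : Function.Injective (fderiv ℝ ψ z)) (h1 : ∀ z, ‖ψ z‖ = 1) {w : V}
    (hw : inner ℝ (ψ z) w = 0) (hw' : ∀ l, inner ℝ (vpd l ψ z) w = 0) : w = 0 := by
  -- The position and the m coordinate vectors are m + 1 independent vectors in dimension m + 1, so
  -- they span V and w is orthogonal to everything.
  have hli : LinearIndependent ℝ (Fin.cons (ψ z) (fun l => vpd l ψ z) : Fin (m + 1) → V) := by
    rw [linearIndependent_finCons]
    refine ⟨vpd_linearIndependent hinj, fun hmem => ?_⟩
    have : ∀ v ∈ Submodule.span ℝ (range fun l => vpd l ψ z), inner ℝ (ψ z) v = 0 := by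
      intro v hv
      induction hv using Submodule.span_induction with
      | mem x hx => obtain ⟨l, rfl⟩ := hx; exact inner_vpd_eq_zero hψ h1 l
      | zero => simp
      | add x y _ _ hx hy => rw [inner_add_right, hx, hy, add_zero]
      | smul a x _ hx => rw [real_inner_smul_right, hx, mul_zero]
    have h := this _ hmem
    rw [real_inner_self_eq_norm_sq, h1] at h
    norm_num at h
  have hspan := hli.span_eq_top_of_card_eq_finrank (by
    rw [Fintype.card_fin, (Fact.out : finrank ℝ V = m + 1)])
  have : ∀ v ∈ Submodule.span ℝ (range (Fin.cons (ψ z) (fun l => vpd l ψ z) : Fin (m + 1) → V)),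
      inner ℝ v w = 0 := by
    intro v hv
    induction hv using Submodule.span_induction with
    | mem x hx =>
      obtain ⟨l, rfl⟩ := hx
      refine Fin.cases ?_ (fun l => ?_) l
      · simpa using hw
      · simpa using hw' l
    | zero => simp
    | add x y _ _ hx hy => rw [inner_add_left, hx, hy, add_zero]
    | smul a x _ hx => rw [real_inner_smul_left, hx, mul_zero]
  exact inner_self_eq_zero.1 (this w (hspan ▸ Submodule.mem_top))

/-- The Gauss formula for a parametrization of the unit sphere. -/
theorem vpd_vpd_eq_gauss [Fact (finrank ℝ V = m + 1)] {ψ : EuclideanSpace ℝ (Fin m) → V}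
    {z : EuclideanSpace ℝ (Fin m)} (hψ : ContDiffAt ℝ 2 ψ z)
    (hinj : Function.Injective (fderiv ℝ ψ z)) (h1 : ∀ z, ‖ψ z‖ = 1) (i j : Fin m) :
    vpd i (vpd j ψ) z =
      ∑ k, christoffel (gram ψ) z k i j • vpd k ψ z - gram ψ z i j • ψ z := by
  have hd := hψ.differentiableAt (by norm_num)
  rw [← sub_eq_zero]
  -- The difference of the two sides is tested against ψ, where both give -⟨∂_i ψ, ∂_j ψ⟩, and
  -- against ∂_l ψ, where the Christoffel sum has the right products.
  refine eq_zero_of_inner_vpd hd hinj h1 ?_ fun l => ?_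
  · rw [inner_sub_right, inner_sub_right, inner_vpd_vpd hψ h1, inner_sum, real_inner_smul_right,
      real_inner_self_eq_norm_sq, h1]
    simp [real_inner_smul_right, inner_vpd_eq_zero hd h1, gram]
  · rw [inner_sub_right, inner_sub_right, real_inner_comm, real_inner_comm (∑ k, _),
      inner_sum_christoffel hψ hinj, real_inner_smul_right, real_inner_comm (ψ z),
      inner_vpd_eq_zero hd h1]
    simp

/-- For a map into the unit sphere, the covariant derivative in coordinates represents the
tangential part of the second derivative in the ambient space. -/
theorem sum_covDeriv_smul [Fact (finrank ℝ V = m + 1)] {ψ : EuclideanSpace ℝ (Fin m) → V}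
    {u : EuclideanSpace ℝ (Fin n) → EuclideanSpace ℝ (Fin m)} {U : EuclideanSpace ℝ (Fin n) → V}
    {y : EuclideanSpace ℝ (Fin n)} (hψ : ContDiffAt ℝ 2 ψ (u y)) (hu : ContDiffAt ℝ 2 u y)
    (hinj : Function.Injective (fderiv ℝ ψ (u y))) (h1 : ∀ z, ‖ψ z‖ = 1)
    (hU : U =ᶠ[𝓝 y] fun z => ψ (u z)) (i j : Fin n) :
    ∑ α, (vpd i (vpd j (fun z => u z α)) y + ∑ β, ∑ γ, christoffel (gram ψ) (u y) α β γ *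
        vpd i (fun z => u z β) y * vpd j (fun z => u z γ) y) • vpd α ψ (u y) =
      vpd i (vpd j U) y + (inner ℝ (vpd i U y) (vpd j U y) : ℝ) • U y := by
  have hψ1 := hψ.differentiableAt (by norm_num)
  have hu1 := hu.differentiableAt (by norm_num)
  have hev : vpd j U =ᶠ[𝓝 y] vpd j (fun z => ψ (u z)) := by
    filter_upwards [hU.eventuallyEq_nhds] with z hz
    exact vpd_congr hz j
  rw [vpd_congr hev, vpd_vpd_comp hψ hu, vpd_congr hU, vpd_congr hU, hU.self_of_nhds,
    vpd_comp hψ1 hu1, vpd_comp hψ1 hu1]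
  simp only [add_smul, Finset.sum_add_distrib, vpd_vpd_eq_gauss hψ hinj h1]
  rw [add_assoc]
  congr 1
  simp only [sum_inner, inner_sum, real_inner_smul_left, real_inner_smul_right, smul_sub,
    Finset.sum_sub_distrib, Finset.sum_smul, smul_smul, Finset.smul_sum]
  -- Here b is the Christoffel part and c the radial part of the Gauss formula, while d is the added
  -- term ⟨∂_i U, ∂_j U⟩ U expanded by the chain rule; c and d cancel.
  have key (a b c d : V) (hab : a = b) (hcd : c = d) : a = b - c + d := by
    rw [hab, hcd, sub_add_cancel]
  apply key
  · rw [Finset.sum_comm]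
    refine Finset.sum_congr rfl fun β _ => ?_
    rw [Finset.sum_comm]
    refine Finset.sum_congr rfl fun γ _ => Finset.sum_congr rfl fun α _ => ?_
    congr 1; ring
  · rw [Finset.sum_comm]
    refine Finset.sum_congr rfl fun β _ => Finset.sum_congr rfl fun γ _ => ?_
    congr 1; simp only [gram, Matrix.of_apply]; ring

end Sphere

/-! ### Traces of bilinear forms and simultaneous diagonalization. -/

section Trace

variable {n : ℕ} {E V W : Type*} [AddCommGroup E] [Module ℝ E]
  [NormedAddCommGroup V] [InnerProductSpace ℝ V] [NormedAddCommGroup W] [InnerProductSpace ℝ W]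

/-- The trace of a bilinear form `a` with respect to `g`, computed in a basis that diagonalizes
both. -/
theorem sum_inv_toMatrix_mul (b e : Basis (Fin n) ℝ E) (a g : LinearMap.BilinForm ℝ E)
    (μ ν : Fin n → ℝ) (hν : ∀ i, ν i ≠ 0)
    (ha : ∀ i j, a (e i) (e j) = if i = j then μ i else 0)
    (hg : ∀ i j, g (e i) (e j) = if i = j then ν i else 0) :
    ∑ i, ∑ j, (LinearMap.BilinForm.toMatrix b g)⁻¹ i j * a (b i) (b j) = ∑ i, μ i / ν i := by
  -- P and Q are mutually inverse. Both forms have matrices Qᵀ D Q with D diagonal, the inverse of g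
  -- is P D⁻¹ Pᵀ, and cyclicity of the trace removes P and Q.
  set P := b.toMatrix e with hP
  set Q := e.toMatrix b with hQ
  have hPQ : P * Q = 1 := b.toMatrix_mul_toMatrix_flip e
  have hQP : Q * P = 1 := e.toMatrix_mul_toMatrix_flip b
  have hG : LinearMap.BilinForm.toMatrix b g = Qᵀ * Matrix.diagonal ν * Q := by
    rw [← LinearMap.BilinForm.toMatrix_mul_basis_toMatrix e b g]
    congr 2
    ext i j
    rw [LinearMap.BilinForm.toMatrix_apply, hg, Matrix.diagonal_apply]
  have hA : LinearMap.BilinForm.toMatrix b a = Qᵀ * Matrix.diagonal μ * Q := by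
    rw [← LinearMap.BilinForm.toMatrix_mul_basis_toMatrix e b a]
    congr 2
    ext i j
    rw [LinearMap.BilinForm.toMatrix_apply, ha, Matrix.diagonal_apply]
  have hinv : (LinearMap.BilinForm.toMatrix b g)⁻¹ = P * Matrix.diagonal ν⁻¹ * Pᵀ := by
    refine Matrix.inv_eq_right_inv ?_
    have h1 : Matrix.diagonal ν * Matrix.diagonal ν⁻¹ = 1 := by
      rw [Matrix.diagonal_mul_diagonal, ← Matrix.diagonal_one]
      congr 1; funext i; simp [hν i]
    have h2 : Qᵀ * Pᵀ = 1 := by rw [← Matrix.transpose_mul, hPQ, Matrix.transpose_one]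
    calc _ = Qᵀ * (Matrix.diagonal ν * (Q * P) * Matrix.diagonal ν⁻¹) * Pᵀ := by
          rw [hG]; simp only [Matrix.mul_assoc]
      _ = 1 := by rw [hQP, Matrix.mul_one, h1, Matrix.mul_one, h2]
  have hPQT : Pᵀ * Qᵀ = 1 := by rw [← Matrix.transpose_mul, hQP, Matrix.transpose_one]
  have htr : ∑ i, ∑ j, (LinearMap.BilinForm.toMatrix b g)⁻¹ i j * a (b i) (b j) =
      ((LinearMap.BilinForm.toMatrix b g)⁻¹ * (LinearMap.BilinForm.toMatrix b a)ᵀ).trace := by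
    simp [Matrix.trace, Matrix.mul_apply]
  rw [htr, hA, hinv, Matrix.transpose_mul, Matrix.transpose_mul, Matrix.transpose_transpose,
    Matrix.diagonal_transpose]
  calc _ = (P * (Matrix.diagonal ν⁻¹ * (Pᵀ * Qᵀ) * Matrix.diagonal μ) * Q).trace := by
        simp only [Matrix.mul_assoc]
    _ = _ := by
        rw [hPQT, Matrix.mul_one, Matrix.trace_mul_cycle, hQP, Matrix.one_mul,
          Matrix.diagonal_mul_diagonal, Matrix.trace_diagonal]
        exact Finset.sum_congr rfl fun i _ => by simp [div_eq_inv_mul]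

/-- Two pulled back inner products, one of them definite, can be diagonalized simultaneously. -/
theorem exists_basis_diagonal [FiniteDimensional ℝ V] [FiniteDimensional ℝ W]
    (hn : finrank ℝ E = n) (T : E →ₗ[ℝ] V) (R : E →ₗ[ℝ] W) (hT : Function.Injective T) :
    ∃ (e : Basis (Fin n) ℝ E) (l : Fin n → ℝ), ∀ i j,
      inner ℝ (T (e i)) (T (e j)) = (if i = j then (1 : ℝ) else 0) ∧
      inner ℝ (R (e i)) (R (e j)) = (if i = j then l i ^ 2 else (0 : ℝ)) := by
  set φ := LinearEquiv.ofInjective T hT with hφ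
  -- On the range of T the first form is the ambient inner product and the second is ⟨Cx, Cy⟩, so an
  -- orthonormal eigenbasis w of C*C diagonalizes both. Taking l i = ‖C (w i)‖ exhibits the diagonal
  -- entries as squares.
  set C : T.range →ₗ[ℝ] W := R ∘ₗ φ.symm.toLinearMap with hC
  have hsym : (LinearMap.adjoint C ∘ₗ C).IsSymmetric := fun x y => by
    simp [LinearMap.adjoint_inner_left, LinearMap.adjoint_inner_right]
  have hr : finrank ℝ T.range = n := by rw [← φ.finrank_eq, hn]
  set w := hsym.eigenvectorBasis hr with hw
  refine ⟨w.toBasis.map φ.symm, fun i => ‖C (w i)‖, fun i j => ?_⟩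
  have hTe (i : Fin n) : T (φ.symm (w i)) = (w i : V) := by
    have : (φ (φ.symm (w i)) : V) = T (φ.symm (w i)) := rfl
    rw [← this, φ.apply_symm_apply]
  have hRe (i : Fin n) : R (φ.symm (w i)) = C (w i) := rfl
  simp only [Basis.map_apply, OrthonormalBasis.coe_toBasis, hTe, hRe]
  refine ⟨?_, ?_⟩
  · rw [← Submodule.coe_inner]; exact orthonormal_iff_ite.1 w.orthonormal i j
  · split_ifs with h
    · subst h; rw [real_inner_self_eq_norm_sq]
    · rw [← LinearMap.adjoint_inner_right]
      change inner ℝ (w i) ((LinearMap.adjoint C ∘ₗ C) (w j)) = 0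
      rw [hsym.apply_eigenvectorBasis hr j, inner_smul_right]
      have := orthonormal_iff_ite.1 w.orthonormal i j
      rw [← hw, this, if_neg h, mul_zero]

end Trace

/-! ### Stereographic charts and coordinate representations. -/

section Chart

variable {n m : ℕ} {V V' : Type*} [NormedAddCommGroup V] [InnerProductSpace ℝ V]
  [Fact (finrank ℝ V = m + 1)] [NormedAddCommGroup V'] [InnerProductSpace ℝ V']
  [Fact (finrank ℝ V' = n + 1)]

/-- Stereographic projection is onto, so the inverse chart, and with it `chartRep`, is a C²
parametrization on all of ℝ^n, with no domain to track. -/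
theorem chartAt_sphere_target (p : sphere (0 : V') 1) :
    (chartAt (EuclideanSpace ℝ (Fin n)) p).target = univ :=
  stereographic'_target (-p)

theorem contMDiff_chartAt_sphere_symm (p : sphere (0 : V') 1) :
    ContMDiff (𝓡 n) (𝓡 n) 2 (chartAt (EuclideanSpace ℝ (Fin n)) p).symm := by
  have h := contMDiffOn_chart_symm (I := 𝓡 n) (n := 2) (x := p)
  rw [chartAt_sphere_target] at h
  exact contMDiffOn_univ.1 h

/-- The coordinate representation around `p` of a map on the sphere, the target being left
unchanged. -/
def chartRep {W : Type*} (f : sphere (0 : V') 1 → W) (p : sphere (0 : V') 1)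
    (y : EuclideanSpace ℝ (Fin n)) : W :=
  f ((chartAt (EuclideanSpace ℝ (Fin n)) p).symm y)

theorem contDiff_chartRep {W : Type*} [NormedAddCommGroup W] [NormedSpace ℝ W]
    {f : sphere (0 : V') 1 → W} (hf : ContMDiff (𝓡 n) 𝓘(ℝ, W) 2 f) (p : sphere (0 : V') 1) :
    ContDiff ℝ 2 (chartRep (n := n) f p) :=
  contMDiff_iff_contDiff.1 (hf.comp (contMDiff_chartAt_sphere_symm p))

theorem fderiv_chartRep {W : Type*} [NormedAddCommGroup W] [NormedSpace ℝ W]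
    {f : sphere (0 : V') 1 → W} (hf : ContMDiff (𝓡 n) 𝓘(ℝ, W) 2 f) (p : sphere (0 : V') 1)
    (y v : EuclideanSpace ℝ (Fin n)) :
    fderiv ℝ (chartRep (n := n) f p) y v =
      mfderiv (𝓡 n) 𝓘(ℝ, W) f ((chartAt (EuclideanSpace ℝ (Fin n)) p).symm y)
        (mfderiv (𝓡 n) (𝓡 n) (chartAt (EuclideanSpace ℝ (Fin n)) p).symm y v) := by
  rw [← mfderiv_eq_fderiv]
  have h := mfderiv_comp (I := 𝓡 n) (I' := 𝓡 n) (I'' := 𝓘(ℝ, W)) y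
    ((hf.mdifferentiable (by norm_num)) _)
    ((contMDiff_chartAt_sphere_symm (n := n) p).mdifferentiable (by norm_num) y)
  exact congrArg (fun L => L v) h

theorem mfderiv_chartAt_sphere_symm_injective (p : sphere (0 : V') 1)
    (y : EuclideanSpace ℝ (Fin n)) : Function.Injective
      (mfderiv (𝓡 n) (𝓡 n) (chartAt (EuclideanSpace ℝ (Fin n)) p).symm y) := by
  have h := (mdifferentiable_chart (I := 𝓡 n) p).symm
  exact h.mfderiv_injective (by
    rw [OpenPartialHomeomorph.symm_source, chartAt_sphere_target]; exact mem_univ y)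

theorem norm_chartRep_coe {V : Type*} [NormedAddCommGroup V]
    (φ : sphere (0 : V') 1 → sphere (0 : V) 1) (p : sphere (0 : V') 1)
    (y : EuclideanSpace ℝ (Fin n)) : ‖chartRep (n := n) (fun x => (φ x : V)) p y‖ = 1 :=
  mem_sphere_zero_iff_norm.1 (φ _).2

theorem contMDiff_coe_comp {φ : sphere (0 : V') 1 → sphere (0 : V) 1}
    (hφ : ContMDiff (𝓡 n) (𝓡 m) 2 φ) : ContMDiff (𝓡 n) 𝓘(ℝ, V) 2 (fun x => (φ x : V)) :=
  contMDiff_coe_sphere.comp hφ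

theorem mfderiv_coe_comp {φ : sphere (0 : V') 1 → sphere (0 : V) 1}
    (hφ : ContMDiff (𝓡 n) (𝓡 m) 2 φ) (x : sphere (0 : V') 1) (v : TangentSpace (𝓡 n) x) :
    mfderiv (𝓡 n) 𝓘(ℝ, V) (fun x => (φ x : V)) x v =
      mfderiv (𝓡 m) 𝓘(ℝ, V) (fun x : sphere (0 : V) 1 => (x : V)) (φ x)
        (mfderiv (𝓡 n) (𝓡 m) φ x v) := by
  have h := mfderiv_comp (I := 𝓡 n) (I' := 𝓡 m) (I'' := 𝓘(ℝ, V)) x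
    ((contMDiff_coe_sphere (E := V) (n := m) (m := 2)).mdifferentiable (by norm_num) (φ x))
    (hφ.mdifferentiable (by norm_num) x)
  exact congrArg (fun L => L v) h

/-- The differential of a vector-valued map on the sphere. -/
def sphereDeriv {W : Type*} [NormedAddCommGroup W] [NormedSpace ℝ W]
    (f : sphere (0 : V') 1 → W) (x : sphere (0 : V') 1) : TangentSpace (𝓡 n) x →ₗ[ℝ] W :=
  (mfderiv (𝓡 n) 𝓘(ℝ, W) f x).toLinearMap

theorem sphereDeriv_coe_injective (x : sphere (0 : V') 1) : Function.Injective
    (sphereDeriv (n := n) (fun x : sphere (0 : V') 1 => (x : V')) x) :=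
  injective_mvfderiv_subtypeVal_sphere x

theorem pullback_roundMetric_apply {φ : sphere (0 : V') 1 → sphere (0 : V) 1}
    (hφ : ContMDiff (𝓡 n) (𝓡 m) 2 φ) (x : sphere (0 : V') 1) (v w : TangentSpace (𝓡 n) x) :
    pullback (n := n) (m := m) φ (roundMetric V) x v w =
      inner ℝ (sphereDeriv (fun x => (φ x : V)) x v) (sphereDeriv (fun x => (φ x : V)) x w) := by
  have h (v : TangentSpace (𝓡 n) x) := mfderiv_coe_comp hφ x v
  change innerₗ V (mfderiv (𝓡 m) 𝓘(ℝ, V) (fun x : sphere (0 : V) 1 => (x : V)) (φ x)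
    (mfderiv (𝓡 n) (𝓡 m) φ x v)) (mfderiv (𝓡 m) 𝓘(ℝ, V) (fun x : sphere (0 : V) 1 => (x : V)) (φ x)
    (mfderiv (𝓡 n) (𝓡 m) φ x w)) = innerₗ V (mfderiv (𝓡 n) 𝓘(ℝ, V) (fun x => (φ x : V)) x v)
      (mfderiv (𝓡 n) 𝓘(ℝ, V) (fun x => (φ x : V)) x w)
  rw [h, h]

theorem roundMetric_apply (x : sphere (0 : V') 1) (v w : TangentSpace (𝓡 n) x) :
    roundMetric (n := n) V' x v w =
      inner ℝ (sphereDeriv (fun x : sphere (0 : V') 1 => (x : V')) x v)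
        (sphereDeriv (fun x : sphere (0 : V') 1 => (x : V')) x w) := rfl

/-- The coordinate vector `∂_i` of the preferred chart around `p`, at the coordinates `y`. -/
def coordVector (p : sphere (0 : V') 1) (y : EuclideanSpace ℝ (Fin n)) (i : Fin n) :
    TangentSpace (𝓡 n) ((chartAt (EuclideanSpace ℝ (Fin n)) p).symm y) :=
  mfderiv (𝓡 n) (𝓡 n) (chartAt (EuclideanSpace ℝ (Fin n)) p).symm y
    (EuclideanSpace.single i 1 : EuclideanSpace ℝ (Fin n))

theorem vpd_chartRep {W : Type*} [NormedAddCommGroup W] [NormedSpace ℝ W]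
    {f : sphere (0 : V') 1 → W} (hf : ContMDiff (𝓡 n) 𝓘(ℝ, W) 2 f) (p : sphere (0 : V') 1)
    (y : EuclideanSpace ℝ (Fin n)) (i : Fin n) :
    vpd i (chartRep (n := n) f p) y = sphereDeriv f _ (coordVector p y i) :=
  fderiv_chartRep hf p y _

/-- The equality is one of functions of the coordinates, not only of values at p, because the
Christoffel symbols differentiate the coefficients. -/
theorem coeff_pullback {φ : sphere (0 : V') 1 → sphere (0 : V) 1}
    (hφ : ContMDiff (𝓡 n) (𝓡 m) 2 φ) (p : sphere (0 : V') 1) :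
    coeff (pullback (n := n) (m := m) φ (roundMetric V)) p =
      gram (chartRep (n := n) (fun x => (φ x : V)) p) := by
  funext y; ext i j
  simp only [gram, Matrix.of_apply, vpd_chartRep (contMDiff_coe_comp hφ)]
  exact pullback_roundMetric_apply hφ _ _ _

theorem coeff_roundMetric (p : sphere (0 : V') 1) :
    coeff (roundMetric (n := n) V') p =
      gram (chartRep (n := n) (fun x : sphere (0 : V') 1 => (x : V')) p) := by
  funext y; ext i j
  simp only [gram, Matrix.of_apply, vpd_chartRep (contMDiff_coe_sphere (E := V') (n := n) (m := 2))]
  exact roundMetric_apply _ _ _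

theorem fderiv_chartRep_coe_injective (p : sphere (0 : V') 1) (y : EuclideanSpace ℝ (Fin n)) :
    Function.Injective
      (fderiv ℝ (chartRep (n := n) (fun x : sphere (0 : V') 1 => (x : V')) p) y) := by
  intro v w hvw
  rw [fderiv_chartRep (contMDiff_coe_sphere (E := V') (n := n) (m := 2)),
    fderiv_chartRep (contMDiff_coe_sphere (E := V') (n := n) (m := 2))] at hvw
  exact mfderiv_chartAt_sphere_symm_injective p y (sphereDeriv_coe_injective _ hvw)

/-- The coordinate representation of `φ` in the preferred charts around `p` and `φ p`. -/
def chartsRep (φ : sphere (0 : V') 1 → sphere (0 : V) 1) (p : sphere (0 : V') 1)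
    (y : EuclideanSpace ℝ (Fin n)) : EuclideanSpace ℝ (Fin m) :=
  chartAt (EuclideanSpace ℝ (Fin m)) (φ p) (φ ((chartAt (EuclideanSpace ℝ (Fin n)) p).symm y))

theorem chart_symm_chart (p : sphere (0 : V') 1) :
    (chartAt (EuclideanSpace ℝ (Fin n)) p).symm (chartAt (EuclideanSpace ℝ (Fin n)) p p) = p :=
  (chartAt (EuclideanSpace ℝ (Fin n)) p).left_inv (mem_chart_source _ p)

theorem eventually_mem_source {φ : sphere (0 : V') 1 → sphere (0 : V) 1} (hφ : Continuous φ)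
    (p : sphere (0 : V') 1) :
    ∀ᶠ y in 𝓝 (chartAt (EuclideanSpace ℝ (Fin n)) p p),
      φ ((chartAt (EuclideanSpace ℝ (Fin n)) p).symm y) ∈
        (chartAt (EuclideanSpace ℝ (Fin m)) (φ p)).source := by
  have hc := (hφ.comp (contMDiff_chartAt_sphere_symm (n := n) p).continuous).continuousAt
    (x := chartAt (EuclideanSpace ℝ (Fin n)) p p)
  refine hc.eventually ((chartAt (EuclideanSpace ℝ (Fin m)) (φ p)).open_source.mem_nhds ?_)
  rw [Function.comp_apply, chart_symm_chart]
  exact mem_chart_source _ _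

theorem contDiffAt_chartsRep {φ : sphere (0 : V') 1 → sphere (0 : V) 1}
    (hφ : ContMDiff (𝓡 n) (𝓡 m) 2 φ) (p : sphere (0 : V') 1) :
    ContDiffAt ℝ 2 (chartsRep (n := n) (m := m) φ p) (chartAt (EuclideanSpace ℝ (Fin n)) p p) := by
  have h1 : ContMDiffAt (𝓡 m) (𝓡 m) 2 (chartAt (EuclideanSpace ℝ (Fin m)) (φ p))
      (φ ((chartAt (EuclideanSpace ℝ (Fin n)) p).symm
        (chartAt (EuclideanSpace ℝ (Fin n)) p p))) := by
    rw [chart_symm_chart]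
    exact contMDiffAt_of_mem_maximalAtlas
      (IsManifold.chart_mem_maximalAtlas (φ p)) (mem_chart_source _ _)
  have h2 := (hφ.comp (contMDiff_chartAt_sphere_symm (n := n) p)).contMDiffAt
    (x := chartAt (EuclideanSpace ℝ (Fin n)) p p)
  exact contMDiffAt_iff_contDiffAt.1 (ContMDiffAt.comp _ h1 h2)

/-- The chart around φ p does not cover the whole sphere, so the factorization through it is only
local; this suffices for derivatives at p. -/
theorem chartRep_eventuallyEq {φ : sphere (0 : V') 1 → sphere (0 : V) 1} (hφ : Continuous φ)
    (p : sphere (0 : V') 1) :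
    chartRep (n := n) (fun x => (φ x : V)) p =ᶠ[𝓝 (chartAt (EuclideanSpace ℝ (Fin n)) p p)]
      fun y => chartRep (n := m) (fun x : sphere (0 : V) 1 => (x : V)) (φ p)
        (chartsRep (n := n) (m := m) φ p y) := by
  filter_upwards [eventually_mem_source (n := n) (m := m) hφ p] with y hy
  simp only [chartRep, chartsRep]
  rw [(chartAt (EuclideanSpace ℝ (Fin m)) (φ p)).left_inv hy]

theorem chartsRep_self (φ : sphere (0 : V') 1 → sphere (0 : V) 1) (p : sphere (0 : V') 1) :
    chartsRep (n := n) (m := m) φ p (chartAt (EuclideanSpace ℝ (Fin n)) p p) =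
      chartAt (EuclideanSpace ℝ (Fin m)) (φ p) (φ p) := by
  simp only [chartsRep]; rw [chart_symm_chart]

end Chart

/-! ### Tension field and mean curvature as ambient vectors. -/

section Fields

variable {n m : ℕ} {V V' : Type*} [NormedAddCommGroup V] [InnerProductSpace ℝ V]
  [Fact (finrank ℝ V = m + 1)] [NormedAddCommGroup V'] [InnerProductSpace ℝ V']
  [Fact (finrank ℝ V' = n + 1)]

/-- The ambient vector with components `c` in the preferred chart around `q`. -/
def ofComponents (q : sphere (0 : V) 1) : (Fin m → ℝ) →ₗ[ℝ] V :=
  Fintype.linearCombination ℝ fun α =>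
    vpd α (chartRep (n := m) (fun x : sphere (0 : V) 1 => (x : V)) q)
      (chartAt (EuclideanSpace ℝ (Fin m)) q q)

theorem ofComponents_apply (q : sphere (0 : V) 1) (c : Fin m → ℝ) : ofComponents q c =
    ∑ α, c α • vpd α (chartRep (n := m) (fun x : sphere (0 : V) 1 => (x : V)) q)
      (chartAt (EuclideanSpace ℝ (Fin m)) q q) := rfl

/-- Coordinate vectors are independent, so a field given by components may be tested for vanishing
as an ambient vector. -/
theorem ofComponents_eq_zero_iff (q : sphere (0 : V) 1) (c : Fin m → ℝ) :
    ofComponents q c = 0 ↔ ∀ α, c α = 0 := by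
  constructor
  · exact Fintype.linearIndependent_iff.1
      (vpd_linearIndependent (fderiv_chartRep_coe_injective q _)) c
  · intro h; rw [ofComponents_apply]; simp [h]

theorem inner_ofComponents (q : sphere (0 : V) 1) (c d : Fin m → ℝ) :
    inner ℝ (ofComponents q c) (ofComponents q d) =
      ∑ β, ∑ γ, coeff (roundMetric (n := m) V) q (chartAt (EuclideanSpace ℝ (Fin m)) q q) β γ *
        c β * d γ := by
  rw [coeff_roundMetric, ofComponents_apply, ofComponents_apply, sum_inner]
  refine Finset.sum_congr rfl fun β _ => ?_
  rw [inner_sum]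
  refine Finset.sum_congr rfl fun γ _ => ?_
  rw [real_inner_smul_left, real_inner_smul_right, gram, Matrix.of_apply]
  ring

theorem ofComponents_pd {φ : sphere (0 : V') 1 → sphere (0 : V) 1}
    (hφ : ContMDiff (𝓡 n) (𝓡 m) 2 φ) (p : sphere (0 : V') 1) (k : Fin n) :
    ofComponents (φ p) (fun α => pd k (localRep (n := n) (m := m) φ p α)
        (chartAt (EuclideanSpace ℝ (Fin n)) p p)) =
      vpd k (chartRep (n := n) (fun x => (φ x : V)) p)
        (chartAt (EuclideanSpace ℝ (Fin n)) p p) := by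
  rw [vpd_congr (chartRep_eventuallyEq (n := n) (m := m) hφ.continuous p),
    vpd_comp ((contDiff_chartRep (contMDiff_coe_sphere (n := m)) (φ p)).contDiffAt.differentiableAt
      (by norm_num)) ((contDiffAt_chartsRep hφ p).differentiableAt (by norm_num)),
    chartsRep_self]
  rfl

theorem chartRep_self {W : Type*} (f : sphere (0 : V') 1 → W) (p : sphere (0 : V') 1) :
    chartRep (n := n) f p (chartAt (EuclideanSpace ℝ (Fin n)) p p) = f p := by
  simp only [chartRep]; rw [chart_symm_chart]

/-- The covariant derivative is ∂_i ∂_j φ without its radial part -⟨∂_i φ, ∂_j φ⟩ φ. The Christoffel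
symbols of the target are gone from the right side. -/
theorem ofComponents_covDeriv {φ : sphere (0 : V') 1 → sphere (0 : V) 1}
    (hφ : ContMDiff (𝓡 n) (𝓡 m) 2 φ) (p : sphere (0 : V') 1) (i j : Fin n) :
    ofComponents (φ p) (covDeriv (n := n) (roundMetric (n := m) V) φ p i j) =
      vpd i (vpd j (chartRep (n := n) (fun x => (φ x : V)) p))
        (chartAt (EuclideanSpace ℝ (Fin n)) p p) +
      (inner ℝ (vpd i (chartRep (n := n) (fun x => (φ x : V)) p)
        (chartAt (EuclideanSpace ℝ (Fin n)) p p)) (vpd j (chartRep (n := n) (fun x => (φ x : V)) p)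
        (chartAt (EuclideanSpace ℝ (Fin n)) p p)) : ℝ) • (φ p : V) := by
  have h := sum_covDeriv_smul
    (contDiff_chartRep (contMDiff_coe_sphere (n := m)) (φ p)).contDiffAt (contDiffAt_chartsRep hφ p)
    (fderiv_chartRep_coe_injective (φ p) _) (fun z => norm_chartRep_coe (fun x => x) (φ p) z)
    (chartRep_eventuallyEq hφ.continuous p) i j
  rw [chartsRep_self] at h
  rw [chartRep_self] at h
  rw [← h]
  rw [ofComponents_apply]
  unfold covDeriv
  rw [coeff_roundMetric]
  rfl

/-- The trace, with respect to the metric with coefficients `G`, of the Hessian of a vector-valued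
function: its Laplacian. -/
def laplacian {W : Type*} [NormedAddCommGroup W] [NormedSpace ℝ W]
    (G : EuclideanSpace ℝ (Fin n) → Matrix (Fin n) (Fin n) ℝ)
    (U : EuclideanSpace ℝ (Fin n) → W) (y : EuclideanSpace ℝ (Fin n)) : W :=
  ∑ i, ∑ j, (G y)⁻¹ i j • (vpd i (vpd j U) y - ∑ k, christoffel G y k i j • vpd k U y)

/-- The energy density, up to the factor `1/2`. -/
def energy (G : EuclideanSpace ℝ (Fin n) → Matrix (Fin n) (Fin n) ℝ)
    (U : EuclideanSpace ℝ (Fin n) → V) (y : EuclideanSpace ℝ (Fin n)) : ℝ :=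
  ∑ i, ∑ j, (G y)⁻¹ i j * gram U y i j

theorem ofComponents_tension {φ : sphere (0 : V') 1 → sphere (0 : V) 1}
    (hφ : ContMDiff (𝓡 n) (𝓡 m) 2 φ) (g : FormField n (sphere (0 : V') 1))
    (p : sphere (0 : V') 1) :
    ofComponents (φ p) (tension g (roundMetric (n := m) V) φ p) =
      laplacian (coeff g p) (chartRep (n := n) (fun x => (φ x : V)) p)
        (chartAt (EuclideanSpace ℝ (Fin n)) p p) +
      energy (coeff g p) (chartRep (n := n) (fun x => (φ x : V)) p)
        (chartAt (EuclideanSpace ℝ (Fin n)) p p) • (φ p : V) := by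
  set y := chartAt (EuclideanSpace ℝ (Fin n)) p p with hy
  have ht : tension g (roundMetric (n := m) V) φ p =
      ∑ i, ∑ j, (coeff g p y)⁻¹ i j • (covDeriv (roundMetric (n := m) V) φ p i j -
        ∑ k, christoffel (coeff g p) y k i j • fun α => pd k (localRep (n := n) (m := m) φ p α) y) := by
    funext α; simp [tension, hy]
  rw [ht]
  clear_value y
  subst hy
  simp only [map_sum, map_smul, map_sub, ofComponents_covDeriv hφ, ofComponents_pd hφ]
  simp only [laplacian, energy, Finset.sum_smul, ← Finset.sum_add_distrib]
  refine Finset.sum_congr rfl fun i _ => Finset.sum_congr rfl fun j _ => ?_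
  rw [mul_smul, ← smul_add, gram, Matrix.of_apply]
  congr 1
  abel

theorem ofComponents_secondFundamentalForm {F : sphere (0 : V') 1 → sphere (0 : V) 1}
    (hF : ContMDiff (𝓡 n) (𝓡 m) 2 F) (p : sphere (0 : V') 1) (i j : Fin n)
    {U : EuclideanSpace ℝ (Fin n) → V} (hU : U = chartRep (n := n) (fun x => (F x : V)) p)
    {y : EuclideanSpace ℝ (Fin n)} (hy : y = chartAt (EuclideanSpace ℝ (Fin n)) p p) :
    ofComponents (F p) (secondFundamentalForm (n := n) (roundMetric (n := m) V) F p i j) =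
      vpd i (vpd j U) y - ∑ k, christoffel (gram U) y k i j • vpd k U y +
      gram U y i j • (F p : V) := by
  have hU2 : ContDiffAt ℝ 2 U y :=
    hU ▸ (contDiff_chartRep (contMDiff_coe_comp hF) p).contDiffAt
  have hUp : U y = F p := by rw [hU, hy]; exact chartRep_self _ p
  have hs : secondFundamentalForm (n := n) (roundMetric (n := m) V) F p i j =
      covDeriv (roundMetric (n := m) V) F p i j -
        ∑ k, ∑ l, ((gram U y)⁻¹ k l *
          inner ℝ (ofComponents (F p) (covDeriv (roundMetric (n := m) V) F p i j))
            (ofComponents (F p) fun γ => pd l (localRep (n := n) (m := m) F p γ) y)) •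
          fun α => pd k (localRep (n := n) (m := m) F p α) y := by
    funext α
    simp only [secondFundamentalForm, coeff_pullback hF, inner_ofComponents, hy, hU]
    simp
  rw [hs]
  subst hy
  simp only [map_sum, map_smul, map_sub, ofComponents_covDeriv hF, ofComponents_pd hF, ← hU,
    christoffel_gram hU2, Finset.sum_smul]
  -- The radial term is orthogonal to the ∂_l U, so the tangential projection being subtracted is
  -- exactly the Christoffel sum of the induced metric.
  have h0 (l : Fin n) : inner ℝ (F p : V)
      (vpd l U (chartAt (EuclideanSpace ℝ (Fin n)) p p)) = 0 := by
    rw [← hUp]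
    refine inner_vpd_eq_zero (hU2.differentiableAt (by norm_num)) (fun z => ?_) l
    rw [hU]; exact norm_chartRep_coe F p z
  simp only [inner_add_left, real_inner_smul_left, h0, mul_zero, add_zero]
  rw [gram, Matrix.of_apply]
  abel

/-- This is the expression of `ofComponents_tension` for the induced metric, divided by n: the mean
curvature is the normalized tension field of an isometric immersion. -/
theorem ofComponents_meanCurvature {F : sphere (0 : V') 1 → sphere (0 : V) 1}
    (hF : ContMDiff (𝓡 n) (𝓡 m) 2 F) (p : sphere (0 : V') 1) :
    ofComponents (F p) (meanCurvature (n := n) (roundMetric (n := m) V) F p) =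
      (1 / (n : ℝ)) • (laplacian (gram (chartRep (n := n) (fun x => (F x : V)) p))
        (chartRep (n := n) (fun x => (F x : V)) p) (chartAt (EuclideanSpace ℝ (Fin n)) p p) +
      energy (gram (chartRep (n := n) (fun x => (F x : V)) p))
        (chartRep (n := n) (fun x => (F x : V)) p)
        (chartAt (EuclideanSpace ℝ (Fin n)) p p) • (F p : V)) := by
  have hm : meanCurvature (n := n) (roundMetric (n := m) V) F p =
      (1 / (n : ℝ)) • ∑ i, ∑ j, (gram (chartRep (n := n) (fun x => (F x : V)) p)
        (chartAt (EuclideanSpace ℝ (Fin n)) p p))⁻¹ i j •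
          secondFundamentalForm (roundMetric (n := m) V) F p i j := by
    funext α
    simp [meanCurvature, coeff_pullback hF]
  rw [hm]
  simp only [map_sum, map_smul, ofComponents_secondFundamentalForm hF p _ _ rfl rfl]
  congr 1
  simp only [laplacian, energy, Finset.sum_smul, ← Finset.sum_add_distrib]
  refine Finset.sum_congr rfl fun i _ => Finset.sum_congr rfl fun j _ => ?_
  rw [mul_smul, ← smul_add]

end Fields

/-! ### The minimal surface equation for a map with two spherical blocks. -/

section Laplacian

variable {n : ℕ} {V W : Type*} [NormedAddCommGroup V] [InnerProductSpace ℝ V]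
  [NormedAddCommGroup W] [InnerProductSpace ℝ W]
  {G : EuclideanSpace ℝ (Fin n) → Matrix (Fin n) (Fin n) ℝ} {y : EuclideanSpace ℝ (Fin n)}

theorem laplacian_clm_comp (L : V →L[ℝ] W) {U : EuclideanSpace ℝ (Fin n) → V}
    (hU : ContDiffAt ℝ 2 U y) : laplacian G (fun z => L (U z)) y = L (laplacian G U y) := by
  simp only [laplacian, map_sum, map_smul, map_sub, vpd_vpd_clm_comp L hU,
    vpd_clm_comp L (hU.differentiableAt (by norm_num))]

/-- Trace of `inner_vpd_vpd`; the first-order terms are tangent and drop out. -/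
theorem inner_laplacian {U : EuclideanSpace ℝ (Fin n) → V} (hU : ContDiffAt ℝ 2 U y)
    (h1 : ∀ z, ‖U z‖ = 1) : inner ℝ (U y) (laplacian G U y) = - energy G U y := by
  simp only [laplacian, energy, inner_sum, inner_sub_right, real_inner_smul_right,
    inner_vpd_vpd hU h1, inner_vpd_eq_zero (hU.differentiableAt (by norm_num)) h1, gram,
    Matrix.of_apply, ← Finset.sum_neg_distrib]
  simp

/-- The Laplacian of an immersion for the induced metric is normal. -/
theorem inner_laplacian_vpd {U : EuclideanSpace ℝ (Fin n) → V} (hU : ContDiffAt ℝ 2 U y)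
    (hinj : Function.Injective (fderiv ℝ U y)) (l : Fin n) :
    inner ℝ (laplacian (gram U) U y) (vpd l U y) = 0 := by
  simp only [laplacian, sum_inner, inner_sub_left, real_inner_smul_left]
  refine Finset.sum_eq_zero fun i _ => Finset.sum_eq_zero fun j _ => ?_
  have h := inner_sum_christoffel hU hinj i j l
  simp only [sum_inner, real_inner_smul_left] at h
  rw [h, sub_self, mul_zero]

theorem energy_gram {U : EuclideanSpace ℝ (Fin n) → V}
    (hinj : Function.Injective (fderiv ℝ U y)) : energy (gram U) U y = n := by
  have h : energy (gram U) U y = ((gram U y)⁻¹ * (gram U y)ᵀ).trace := by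
    simp [energy, Matrix.trace, Matrix.mul_apply]
  have hs : (gram U y)ᵀ = gram U y := by
    ext i j; exact real_inner_comm _ _
  rw [h, hs, Matrix.nonsing_inv_mul _ (gram_isUnit hinj), Matrix.trace_one, Fintype.card_fin]

/-- For an immersion into the unit sphere of a product whose components are multiples of maps `X`
and `N` into unit spheres, `X` being a parametrization, the equation of minimal submanifolds is
equivalent to the equation of harmonic maps for `N` and the constancy of the energy density of
`X`. -/
theorem laplacian_add_eq_zero_iff [Fact (finrank ℝ V = n + 1)]
    {U : EuclideanSpace ℝ (Fin n) → WithLp 2 (V × W)} {X : EuclideanSpace ℝ (Fin n) → V}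
    {N : EuclideanSpace ℝ (Fin n) → W} {c s : ℝ} (hc : c ≠ 0) (hs : s ≠ 0) (hcs : c ^ 2 + s ^ 2 = 1)
    (hU : ContDiffAt ℝ 2 U y) (hX : ContDiffAt ℝ 2 X y) (hN : ContDiffAt ℝ 2 N y)
    (hUX : ∀ z, (U z).fst = c • X z) (hUN : ∀ z, (U z).snd = s • N z)
    (hX1 : ∀ z, ‖X z‖ = 1) (hN1 : ∀ z, ‖N z‖ = 1) (hinj : Function.Injective (fderiv ℝ X y)) :
    laplacian (gram U) U y + energy (gram U) U y • U y = 0 ↔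
      laplacian (gram U) N y + energy (gram U) N y • N y = 0 ∧ energy (gram U) X y = n := by
  set P : WithLp 2 (V × W) →L[ℝ] V := WithLp.fstL 2 ℝ V W
  set Q : WithLp 2 (V × W) →L[ℝ] W := WithLp.sndL 2 ℝ V W
  have hP (z) : P (U z) = (c • ContinuousLinearMap.id ℝ V) (X z) := hUX z
  have hQ (z) : Q (U z) = (s • ContinuousLinearMap.id ℝ W) (N z) := hUN z
  have hU1 := hU.differentiableAt (n := 2) (by norm_num)
  have hX' := hX.differentiableAt (n := 2) (by norm_num)
  have hN' := hN.differentiableAt (n := 2) (by norm_num)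
  have hdX (i) : (vpd i U y).fst = c • vpd i X y := by
    change P (vpd i U y) = (c • ContinuousLinearMap.id ℝ V) (vpd i X y)
    rw [← vpd_clm_comp P hU1, ← vpd_clm_comp _ hX', funext hP]
  have hdN (i) : (vpd i U y).snd = s • vpd i N y := by
    change Q (vpd i U y) = (s • ContinuousLinearMap.id ℝ W) (vpd i N y)
    rw [← vpd_clm_comp Q hU1, ← vpd_clm_comp _ hN', funext hQ]
  have hlX (G) : (laplacian G U y).fst = c • laplacian G X y := by
    change P (laplacian G U y) = (c • ContinuousLinearMap.id ℝ V) (laplacian G X y)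
    rw [← laplacian_clm_comp P hU, ← laplacian_clm_comp _ hX, funext hP]
  have hlN (G) : (laplacian G U y).snd = s • laplacian G N y := by
    change Q (laplacian G U y) = (s • ContinuousLinearMap.id ℝ W) (laplacian G N y)
    rw [← laplacian_clm_comp Q hU, ← laplacian_clm_comp _ hN, funext hQ]
  have hUinj : Function.Injective (fderiv ℝ U y) := by
    rw [injective_iff_map_eq_zero]
    intro v hv
    refine (injective_iff_map_eq_zero _).1 hinj v ?_
    have h := congrArg WithLp.fst hv
    rw [fderiv_eq_sum_vpd] at h ⊢
    have h' : c • ∑ i, v i • vpd i X y = P (∑ i, v i • vpd i U y) := by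
      rw [map_sum, Finset.smul_sum]
      refine Finset.sum_congr rfl fun i _ => ?_
      rw [map_smul, smul_comm, ← hdX]; rfl
    exact (smul_eq_zero.1 (h'.trans h)).resolve_left hc
  have hgram (i j) : gram U y i j = c ^ 2 * gram X y i j + s ^ 2 * gram N y i j := by
    simp only [gram, Matrix.of_apply, WithLp.prod_inner_apply]
    change inner ℝ (vpd i U y).fst (vpd j U y).fst + inner ℝ (vpd i U y).snd (vpd j U y).snd = _
    rw [hdX, hdX, hdN, hdN]
    simp only [real_inner_smul_left, real_inner_smul_right]
    ring
  -- Trace of the induced metric with respect to itself, split along the two blocks.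
  have hen : (n : ℝ) = c ^ 2 * energy (gram U) X y + s ^ 2 * energy (gram U) N y := by
    rw [← energy_gram hUinj]
    simp only [energy, Finset.mul_sum, ← Finset.sum_add_distrib]
    refine Finset.sum_congr rfl fun i _ => Finset.sum_congr rfl fun j _ => ?_
    rw [hgram]; ring
  rw [energy_gram hUinj]
  have hiX := inner_laplacian (G := gram U) hX hX1
  have hiN := inner_laplacian (G := gram U) hN hN1
  have hXX : inner ℝ (X y) (X y) = (1 : ℝ) := by rw [real_inner_self_eq_norm_sq, hX1, one_pow]
  have hNN : inner ℝ (N y) (N y) = (1 : ℝ) := by rw [real_inner_self_eq_norm_sq, hN1, one_pow]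
  have hfst : (laplacian (gram U) U y + (n : ℝ) • U y).fst =
      c • (laplacian (gram U) X y + (n : ℝ) • X y) := by
    rw [WithLp.add_fst, WithLp.smul_fst, hlX, hUX, smul_add, smul_comm c]
  have hsnd : (laplacian (gram U) U y + (n : ℝ) • U y).snd =
      s • (laplacian (gram U) N y + (n : ℝ) • N y) := by
    rw [WithLp.add_snd, WithLp.smul_snd, hlN, hUN, smul_add, smul_comm s]
  constructor
  · intro h
    rw [h] at hfst hsnd
    have h1 := (smul_eq_zero.1 hfst.symm).resolve_left hc
    have h2 := (smul_eq_zero.1 hsnd.symm).resolve_left hs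
    -- Pairing the X-equation with X reads off the energy of X; likewise for N below.
    have h3 := congrArg (inner ℝ (X y)) h1
    have h4 := congrArg (inner ℝ (N y)) h2
    rw [inner_add_right, hiX, real_inner_smul_right, hXX, inner_zero_right] at h3
    rw [inner_add_right, hiN, real_inner_smul_right, hNN, inner_zero_right] at h4
    have h5 : energy (gram U) N y = n := by linarith
    exact ⟨by rw [h5]; exact h2, by linarith⟩
  · rintro ⟨h1, h2⟩
    have h3 : energy (gram U) N y = n := by
      rw [h2] at hen
      have : s ^ 2 * (energy (gram U) N y - n) = 0 := by linear_combination -hen - (n : ℝ) * hcs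
      have := (mul_eq_zero.1 this).resolve_left (pow_ne_zero 2 hs)
      linarith
    rw [h3] at h1
    -- The radial part is the energy hypothesis. For the tangential part, ΔU is orthogonal to ∂_l U,
    -- and the N-block of that product vanishes since ΔN is a multiple of N, which is orthogonal to
    -- ∂_l N.
    have h4 : laplacian (gram U) X y + (n : ℝ) • X y = 0 := by
      refine eq_zero_of_inner_vpd hX' hinj hX1 ?_ fun l => ?_
      · rw [inner_add_right, hiX, real_inner_smul_right, hXX, h2]; ring
      · have h5 := inner_laplacian_vpd hU hUinj l
        rw [WithLp.prod_inner_apply] at h5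
        change inner ℝ (laplacian (gram U) U y).fst (vpd l U y).fst +
          inner ℝ (laplacian (gram U) U y).snd (vpd l U y).snd = 0 at h5
        rw [hdX, hdN, hlX, hlN, eq_neg_of_add_eq_zero_left h1] at h5
        simp only [real_inner_smul_left, real_inner_smul_right, inner_neg_left,
          inner_vpd_eq_zero hN' hN1] at h5
        rw [inner_add_right, real_inner_smul_right, real_inner_comm (X y),
          inner_vpd_eq_zero hX' hX1, real_inner_comm (laplacian _ _ _)]
        have h6 : c ^ 2 * inner ℝ (laplacian (gram U) X y) (vpd l X y) = 0 := by
          linear_combination h5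
        rw [(mul_eq_zero.1 h6).resolve_left (pow_ne_zero 2 hc)]
        ring
    rw [h4, smul_zero] at hfst
    rw [h1, smul_zero] at hsnd
    exact WithLp.ofLp_injective 2 (Prod.ext hfst hsnd)

end Laplacian

/-! ### The map F_θ and the equivalence for a fixed angle. -/

section Graph

variable {n m : ℕ} {θ : ℝ} {η : S n → S m}

theorem contMDiff_graphMap (hη : ContMDiff (𝓡 n) (𝓡 m) 2 η) :
    ContMDiff (𝓡 n) (𝓡 (m + n + 1)) 2 (graphMap θ η) := by
  refine ContMDiff.codRestrict_sphere (E := Ambient n m) (n := m + n + 1)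
    (f := fun x => (graphMap θ η x : Ambient n m)) ?_ (fun x => (graphMap θ η x).2)
  have h1 : ContMDiff (𝓡 n) 𝓘(ℝ, EuclideanSpace ℝ (Fin (n + 1))) 2
      (fun x : S n => Real.cos θ • (x : EuclideanSpace ℝ (Fin (n + 1)))) :=
    (Real.cos θ • ContinuousLinearMap.id ℝ _).contDiff.contMDiff.comp contMDiff_coe_sphere
  have h2 : ContMDiff (𝓡 n) 𝓘(ℝ, EuclideanSpace ℝ (Fin (m + 1))) 2
      (fun x : S n => Real.sin θ • (η x : EuclideanSpace ℝ (Fin (m + 1)))) :=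
    (Real.sin θ • ContinuousLinearMap.id ℝ _).contDiff.contMDiff.comp (contMDiff_coe_comp hη)
  have h3 := h1.prodMk_space h2
  exact (WithLp.prodContinuousLinearEquiv 2 ℝ (EuclideanSpace ℝ (Fin (n + 1)))
    (EuclideanSpace ℝ (Fin (m + 1)))).symm.contDiff.contMDiff.comp h3

/-- A continuous injection of a compact space into a Hausdorff space is an embedding; the first
block is already injective. -/
theorem isEmbedding_graphMap (hη : ContMDiff (𝓡 n) (𝓡 m) 2 η) (hc : Real.cos θ ≠ 0) :
    Topology.IsEmbedding (graphMap θ η) := by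
  refine ((contMDiff_graphMap hη).continuous.isClosedEmbedding ?_).isEmbedding
  intro x y hxy
  have h : Real.cos θ • (x : EuclideanSpace ℝ (Fin (n + 1))) =
      Real.cos θ • (y : EuclideanSpace ℝ (Fin (n + 1))) :=
    congrArg (fun z : sphere (0 : Ambient n m) 1 => (z : Ambient n m).fst) hxy
  exact Subtype.ext (smul_right_injective _ hc h)

theorem sphereDeriv_graphMap_fst (hη : ContMDiff (𝓡 n) (𝓡 m) 2 η) (x : S n)
    (v : TangentSpace (𝓡 n) x) :
    (sphereDeriv (fun x => (graphMap θ η x : Ambient n m)) x v).fst =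
      Real.cos θ • sphereDeriv (fun x : S n => (x : EuclideanSpace ℝ (Fin (n + 1)))) x v := by
  have h1 := (WithLp.fstL 2 ℝ (EuclideanSpace ℝ (Fin (n + 1)))
    (EuclideanSpace ℝ (Fin (m + 1)))).hasMFDerivAt.comp x
    ((contMDiff_coe_comp (contMDiff_graphMap (θ := θ) hη)).mdifferentiable
      (by norm_num) x).hasMFDerivAt
  have h2 := ((Real.cos θ) • ContinuousLinearMap.id ℝ
    (EuclideanSpace ℝ (Fin (n + 1)))).hasMFDerivAt.comp x
    ((contMDiff_coe_sphere (n := n) (m := 2)).mdifferentiable (by norm_num) x).hasMFDerivAt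
  exact congrArg (fun L => L v) (hasMFDerivAt_unique h1 h2)

theorem sphereDeriv_graphMap_snd (hη : ContMDiff (𝓡 n) (𝓡 m) 2 η) (x : S n)
    (v : TangentSpace (𝓡 n) x) :
    (sphereDeriv (fun x => (graphMap θ η x : Ambient n m)) x v).snd =
      Real.sin θ • sphereDeriv (fun x : S n => (η x : EuclideanSpace ℝ (Fin (m + 1)))) x v := by
  have h1 := (WithLp.sndL 2 ℝ (EuclideanSpace ℝ (Fin (n + 1)))
    (EuclideanSpace ℝ (Fin (m + 1)))).hasMFDerivAt.comp x
    ((contMDiff_coe_comp (contMDiff_graphMap (θ := θ) hη)).mdifferentiable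
      (by norm_num) x).hasMFDerivAt
  have h2 := ((Real.sin θ) • ContinuousLinearMap.id ℝ
    (EuclideanSpace ℝ (Fin (m + 1)))).hasMFDerivAt.comp x
    ((contMDiff_coe_comp hη).mdifferentiable (by norm_num) x).hasMFDerivAt
  exact congrArg (fun L => L v) (hasMFDerivAt_unique h1 h2)

theorem mfderiv_graphMap_injective (hη : ContMDiff (𝓡 n) (𝓡 m) 2 η) (hc : Real.cos θ ≠ 0)
    (x : S n) : Function.Injective (mfderiv (𝓡 n) (𝓡 (m + n + 1)) (graphMap θ η) x) := by
  intro v w hvw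
  have h : sphereDeriv (fun x => (graphMap θ η x : Ambient n m)) x v =
      sphereDeriv (fun x => (graphMap θ η x : Ambient n m)) x w := by
    have h := mfderiv_coe_comp (contMDiff_graphMap (θ := θ) hη) x
    refine (h v).trans (Eq.trans ?_ (h w).symm)
    rw [hvw]
  have h' := congrArg WithLp.fst h
  rw [sphereDeriv_graphMap_fst hη, sphereDeriv_graphMap_fst hη] at h'
  exact sphereDeriv_coe_injective x (smul_right_injective _ hc h')

/-- The blocks are orthogonal and are scaled by cos θ and sin θ. Hence a basis diagonalizing η^*g_m
relative to g_n also diagonalizes the induced metric. -/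
theorem pullback_graphMap_apply (hη : ContMDiff (𝓡 n) (𝓡 m) 2 η) (x : S n)
    (v w : TangentSpace (𝓡 n) x) :
    pullback (n := n) (graphMap θ η) (ambientMetric n m) x v w =
      Real.cos θ ^ 2 * sphereMetric n x v w +
        Real.sin θ ^ 2 * pullback (n := n) η (sphereMetric m) x v w := by
  rw [pullback_roundMetric_apply (contMDiff_graphMap hη), pullback_roundMetric_apply hη,
    roundMetric_apply, WithLp.prod_inner_apply]
  change inner ℝ (sphereDeriv (fun x => (graphMap θ η x : Ambient n m)) x v).fst
      (sphereDeriv (fun x => (graphMap θ η x : Ambient n m)) x w).fst +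
    inner ℝ (sphereDeriv (fun x => (graphMap θ η x : Ambient n m)) x v).snd
      (sphereDeriv (fun x => (graphMap θ η x : Ambient n m)) x w).snd = _
  simp only [sphereDeriv_graphMap_fst hη, sphereDeriv_graphMap_snd hη, real_inner_smul_left,
    real_inner_smul_right]
  ring

/-- The basis of coordinate vectors of the preferred chart around `p`. -/
def coordBasis (p : S n) (y : EuclideanSpace ℝ (Fin n)) :
    Basis (Fin n) ℝ (TangentSpace (𝓡 n) ((chartAt (EuclideanSpace ℝ (Fin n)) p).symm y)) :=
  (EuclideanSpace.basisFun (Fin n) ℝ).toBasis.map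
    (LinearEquiv.ofInjectiveEndo
      (mfderiv (𝓡 n) (𝓡 n) (chartAt (EuclideanSpace ℝ (Fin n)) p).symm y :
        EuclideanSpace ℝ (Fin n) →L[ℝ] EuclideanSpace ℝ (Fin n)).toLinearMap
      (mfderiv_chartAt_sphere_symm_injective p y))

theorem coordBasis_apply (p : S n) (y : EuclideanSpace ℝ (Fin n)) (i : Fin n) :
    coordBasis p y i = coordVector p y i := by
  have h : (EuclideanSpace.basisFun (Fin n) ℝ).toBasis i = EuclideanSpace.single i 1 := by
    rw [OrthonormalBasis.coe_toBasis, EuclideanSpace.basisFun_apply]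
  exact congrArg (mfderiv (𝓡 n) (𝓡 n) (chartAt (EuclideanSpace ℝ (Fin n)) p).symm y) h

/-- The trace of the standard metric with respect to the metric induced by the graph map, in terms
of the relative eigenvalues of the pull-back of the standard metric under `η`. -/
theorem energy_eq_sum (hη : ContMDiff (𝓡 n) (𝓡 m) 2 η) (hc : Real.cos θ ≠ 0) (p : S n)
    (y : EuclideanSpace ℝ (Fin n)) {l : Fin n → ℝ}
    (hl : IsRelEigenvalues
      (pullback (n := n) η (sphereMetric m) ((chartAt (EuclideanSpace ℝ (Fin n)) p).symm y))
      (sphereMetric n ((chartAt (EuclideanSpace ℝ (Fin n)) p).symm y)) fun i => l i ^ 2) :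
    energy (gram (chartRep (n := n) (fun x => (graphMap θ η x : Ambient n m)) p))
      (chartRep (n := n) (fun x : S n => (x : EuclideanSpace ℝ (Fin (n + 1)))) p) y =
      ∑ i, 1 / (Real.cos θ ^ 2 + l i ^ 2 * Real.sin θ ^ 2) := by
  obtain ⟨e, he⟩ := hl
  have h := sum_inv_toMatrix_mul (coordBasis p y) e (sphereMetric n _)
    (pullback (n := n) (graphMap θ η) (ambientMetric n m) _) (fun _ => 1)
    (fun i => Real.cos θ ^ 2 + l i ^ 2 * Real.sin θ ^ 2) (fun i => by positivity)
    (fun i j => (he i j).1) (fun i j => by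
      rw [pullback_graphMap_apply hη, (he i j).1, (he i j).2]
      split_ifs <;> ring)
  rw [← h, energy]
  have hg : gram (chartRep (n := n) (fun x => (graphMap θ η x : Ambient n m)) p) y =
      LinearMap.BilinForm.toMatrix (coordBasis p y)
        (pullback (n := n) (graphMap θ η) (ambientMetric n m) _) := by
    rw [← coeff_pullback (contMDiff_graphMap hη)]
    ext i j
    rw [LinearMap.BilinForm.toMatrix_apply, coordBasis_apply, coordBasis_apply]
    rfl
  rw [hg, ← coeff_roundMetric]
  refine Finset.sum_congr rfl fun i _ => Finset.sum_congr rfl fun j _ => ?_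
  rw [coordBasis_apply, coordBasis_apply]
  rfl

theorem exists_isRelEigenvalues (hη : ContMDiff (𝓡 n) (𝓡 m) 2 η) (x : S n) :
    ∃ l : Fin n → ℝ, IsRelEigenvalues (pullback (n := n) η (sphereMetric m) x)
      (sphereMetric n x) fun i => l i ^ 2 := by
  obtain ⟨e, l, h⟩ := exists_basis_diagonal (E := TangentSpace (𝓡 n) x)
    (finrank_euclideanSpace_fin (𝕜 := ℝ) (n := n))
    (sphereDeriv (fun x : S n => (x : EuclideanSpace ℝ (Fin (n + 1)))) x)
    (sphereDeriv (fun x : S n => (η x : EuclideanSpace ℝ (Fin (m + 1)))) x)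
    (sphereDeriv_coe_injective x)
  refine ⟨l, e, fun i j => ⟨(h i j).1, ?_⟩⟩
  rw [pullback_roundMetric_apply hη]
  exact (h i j).2

/-- The choice of l is immaterial: every admissible l gives the same sum, a trace independent of the
basis, and one always exists. -/
theorem exists_isRelEigenvalues_sum_iff (hη : ContMDiff (𝓡 n) (𝓡 m) 2 η) (hc : Real.cos θ ≠ 0)
    (p : S n) :
    (∃ l : Fin n → ℝ, IsRelEigenvalues (pullback (n := n) η (sphereMetric m) p)
        (sphereMetric n p) (fun i => l i ^ 2) ∧
      ∑ i, 1 / (Real.cos θ ^ 2 + l i ^ 2 * Real.sin θ ^ 2) = (n : ℝ)) ↔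
    energy (gram (chartRep (n := n) (fun x => (graphMap θ η x : Ambient n m)) p))
      (chartRep (n := n) (fun x : S n => (x : EuclideanSpace ℝ (Fin (n + 1)))) p)
      (chartAt (EuclideanSpace ℝ (Fin n)) p p) = n := by
  have h (l : Fin n → ℝ) := energy_eq_sum (l := l) hη hc p (chartAt (EuclideanSpace ℝ (Fin n)) p p)
  rw [chart_symm_chart] at h
  constructor
  · rintro ⟨l, hl, hs⟩
    rw [h l hl, hs]
  · intro he
    obtain ⟨l, hl⟩ := exists_isRelEigenvalues hη p
    exact ⟨l, hl, by rw [← h l hl, he]⟩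

theorem isMinimalEmbedding_graphMap_iff (hη : ContMDiff (𝓡 n) (𝓡 m) 2 η)
    (hθ : θ ∈ Ioo (0 : ℝ) (Real.pi / 2)) :
    IsMinimalEmbedding (n := n) (ambientMetric n m) (graphMap θ η) ↔ HarmonicAndTrace θ η := by
  have hc : Real.cos θ ≠ 0 := (Real.cos_pos_of_mem_Ioo ⟨by linarith [hθ.1, Real.pi_pos], hθ.2⟩).ne'
  have hs : Real.sin θ ≠ 0 :=
    (Real.sin_pos_of_pos_of_lt_pi hθ.1 (by linarith [hθ.2, Real.pi_pos])).ne'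
  have hF := contMDiff_graphMap (θ := θ) hη
  have key (p : S n) :
      (∀ α, meanCurvature (n := n) (ambientMetric n m) (graphMap θ η) p α = 0) ↔
        (∀ α, tension (n := n) (pullback (graphMap θ η) (ambientMetric n m)) (sphereMetric m) η p α
          = 0) ∧ ∃ l : Fin n → ℝ, IsRelEigenvalues (pullback (n := n) η (sphereMetric m) p)
            (sphereMetric n p) (fun i => l i ^ 2) ∧
          ∑ i, 1 / (Real.cos θ ^ 2 + l i ^ 2 * Real.sin θ ^ 2) = (n : ℝ) := by
    rw [exists_isRelEigenvalues_sum_iff hη hc, ← ofComponents_eq_zero_iff (graphMap θ η p),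
      ← ofComponents_eq_zero_iff (η p), ofComponents_tension hη,
      ofComponents_meanCurvature hF, coeff_pullback hF]
    have h := laplacian_add_eq_zero_iff (y := chartAt (EuclideanSpace ℝ (Fin n)) p p)
      hc hs (Real.cos_sq_add_sin_sq θ)
      (contDiff_chartRep (contMDiff_coe_comp hF) p).contDiffAt
      (contDiff_chartRep contMDiff_coe_sphere p).contDiffAt
      (contDiff_chartRep (contMDiff_coe_comp hη) p).contDiffAt
      (fun z => rfl) (fun z => rfl) (fun z => norm_chartRep_coe (fun x => x) p z)
      (fun z => norm_chartRep_coe η p z) (fderiv_chartRep_coe_injective p _)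
    rw [chartRep_self, chartRep_self] at h
    rw [← h]
    -- For n = 0 the factor 1 / n is 0 by convention and cannot be cancelled, but all sums are empty
    -- and both sides hold trivially.
    rcases Nat.eq_zero_or_pos n with rfl | hn
    · simp [laplacian, energy]
    · rw [smul_eq_zero, or_iff_right (by positivity)]
  constructor
  · rintro ⟨-, -, -, h⟩
    exact ⟨⟨hη, fun p => ((key p).1 (h p)).1⟩, fun p => ((key p).1 (h p)).2⟩
  · rintro ⟨⟨-, h1⟩, h2⟩
    exact ⟨hF, isEmbedding_graphMap hη hc, mfderiv_graphMap_injective hη hc,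
      fun p => (key p).2 ⟨h1 p, h2 p⟩⟩

end Graph

end LawsonOsserman

end

theorem theorem1 (n m : ℕ) (η : LawsonOsserman.S n → LawsonOsserman.S m)
    (hη : ContMDiff (𝓡 n) (𝓡 m) 2 η) :
    (LawsonOsserman.IsLawsonOsserman η ↔
      ∃ θ ∈ Set.Ioo (0 : ℝ) (Real.pi / 2), LawsonOsserman.HarmonicAndTrace θ η) ∧
    ∀ θ ∈ Set.Ioo (0 : ℝ) (Real.pi / 2),
      (LawsonOsserman.IsMinimalEmbedding (n := n) (LawsonOsserman.ambientMetric n m)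
          (LawsonOsserman.graphMap θ η) ↔
        LawsonOsserman.HarmonicAndTrace θ η) := by
  refine ⟨?_, fun θ hθ => LawsonOsserman.isMinimalEmbedding_graphMap_iff hη hθ⟩
  constructor
  · rintro ⟨-, θ, hθ, h⟩
    exact ⟨θ, hθ, (LawsonOsserman.isMinimalEmbedding_graphMap_iff hη hθ).1 h⟩
  · rintro ⟨θ, hθ, h⟩
    exact ⟨hη, θ, hθ, (LawsonOsserman.isMinimalEmbedding_graphMap_iff hη hθ).2 h⟩
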